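/- Setting. Let $(E,\langle\cdot,\cdot\rangle)$ and $(H,(\cdot,\cdot))$ be infinite-dimensional real Hilbert spaces with norms $\|\cdot\|$ and $|\cdot|$ and with continuous injections $E\hookrightarrow H\hookrightarrow E'$ (the second one being $h\mapsto (h,\cdot)$), the first of norm at most $1$. For $\mu>0$ let $S_\mu=\{u\in E:|u|^2=\mu\}$, $T_uS_\mu=\{v\in E:(u,v)=0\}$, $B(0,r)=\{u\in E:\|u\|<r\}$ and $B(S_\mu;0,r)=S_\mu\cap B(0,r)$. For a $C^2$ functional $\phi:E\to\mathbb R$, $\phi'|_{S_\mu}(u)$ is the restriction of $\phi'(u)$ to $T_uS_\mu$ with the dual norm from $\|\cdot\|$, and $D^2\phi(u)=\phi''(u)-\frac{\phi'(u)[u]}{|u|^2}(\cdot,\cdot)$. We say that $\phi'$ and $\phi''$ are $\alpha$-Hölder continuous on bounded sets if for every $r>0$ there is $M>0$ such that $\|\phi'(u_1)-\phi'(u_2)\|\le M\|u_1-u_2\|^\alpha$ and $\|\phi''(u_1)-\phi''(u_2)\|\le M\|u_1-u_2\|^\alpha$ (operator norms) for all $u_1,u_2\in B(0,r)$. A pseudogradient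 for $\phi$ constrained to $S_\mu$ is a map $V:S_\mu\to E$ with $V(u)\in T_uS_\mu$, locally Lipschitz on $\{u\in S_\mu:\phi'|_{S_\mu}(u)\ne0\}$, such that for some $a,b>0$ one has $\|V(u)\|\le a\|\phi'|_{S_\mu}(u)\|$ and $\phi'(u)[V(u)]\ge b\|\phi'|_{S_\mu}(u)\|^2$ for all $u\in S_\mu$. Let $\sigma$ be an isometric involution of $\mathbb R^d$. For $D\subset\mathbb R^d$ with $\sigma(D)=D$, a map $g\in C(D,S_\mu)$ is equivariant if $g\circ\sigma=-g$ on $D$. Suprema are taken in $[-\infty,+\infty]$, with $\sup\emptyset=-\infty$; $\inf\emptyset=+\infty$; the distance to or from the empty set is $+\infty$. Let $\phi$ be a $C^2$ functional on $E$ such that $\phi',\phi''$ are $\alpha$-Hölder continuous on bounded sets for some $\alpha\in(0,1]$ and $\phi|_{S_\mu}$ is even. Let $R>1$ and $0<\alpha_1\le\frac{\alpha}{2(\alpha+2)}$. Let $P^*\subset P^{**}$ be (relatively) open subsets of $S_\mu$ with $-P^*=P^*$, $-P^{**}=P^{**}$ and $$\operatorname{dist}\bigl(P^*\cap B(0,R),\;B(S_\mu;0,R)\setminus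 P^{**}\bigr)>0 .$$ Let $V$ be a pseudogradient for $\phi$ constrained to $S_\mu$ such that, for some $C_0\in(0,1]$, $C_0\|\phi'|_{S_\mu}(u)\|\le\|V(u)\|\le\|\phi'|_{S_\mu}(u)\|$ for all $u\in B(S_\mu;0,R)$. For $S\subset S_\mu$ put $S(2\xi)=\{u\in S_\mu:\operatorname{dist}(u,S)\le2\xi\}$. Call $(S,c',\epsilon,\xi)$ admissible if $S\subset S_\mu\setminus\overline{P^{**}}$, $-S=S$, $c'\in\mathbb R$, $\epsilon,\xi>0$, $S(2\xi)\subset B(S_\mu;0,R)\setminus P^*$, and $\|V(u)\|\ge2\epsilon/\xi$ for all $u\in S(2\xi)\setminus\overline{P^{**}}$ with $c'-2\epsilon\le\phi(u)\le c'+2\epsilon$. Assume: (A1) for every admissible $(S,c',\epsilon,\xi)$ there is given $\eta=\eta_{S,c',\epsilon,\xi}\in C([0,\xi]\times S_\mu,S_\mu)$ with $\eta(0,u)=u$ and $\eta(t,-u)=-\eta(t,u)$ such that (i) $\eta(t,u)=u$ for all $t\in[0,\xi]$ unless $u\in S(2\xi)$ and $c'-2\epsilon\le\phi(u)\le c'+2\epsilon$;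 (ii) $\phi(\eta(\cdot,u))$ is nonincreasing on $[0,\xi]$ for every $u\in S_\mu$; (iii) $\eta(t,u)\in\overline{P^{**}}$ for all $t\in[0,\xi]$ and $u\in\overline{P^{**}}$; (iv) for every $u\in S$ with $\phi(u)\le c'+\epsilon$, either $\eta(\xi,u)\in\overline{P^{**}}$ or $\phi(\eta(\xi,u))\le c'-\epsilon$; (A2) $\inf\{\|V(u)\|:u\in B(S_\mu;0,R)\cap\overline{P^{**}}\setminus P^*\}>0$. Let $D\subset\mathbb R^d$ be compact with $\sigma(D)=D$, and let $c\in\mathbb R$ be such that $$c\le\sup\{\phi(u):u\in\eta(\xi,g(D)),\ u\notin\overline{P^{**}}\}$$ for every equivariant $g\in C(D,S_\mu)$ and every $\eta=\eta_{S,c,\epsilon,\xi}$ as in (A1), with $(S,c,\epsilon,\xi)$ admissible. Then there is $\epsilon_0>0$ such that for every $\epsilon\in(0,\epsilon_0)$ and every equivariant $f\in C(D,S_\mu)$ with $\sup_{u\in f(D)\setminus\overline{P^{**}}}\phi(u)\le c+\epsilon$ and $$\{u\in f(D)\setminus P^{**}:\phi(u)\ge c-\epsilon\}\subset B(0,R-1),$$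 there exists $u_\epsilon\in S_\mu$ such that (1) $c-\epsilon\le\phi(u_\epsilon)\le c+\epsilon$; (2) $\|V(u_\epsilon)\|\le3\epsilon^{\alpha_1}$; (3) $u_\epsilon\in f(D)\setminus\overline{P^{**}}$; (4) if $W$ is a subspace of $T_{u_\epsilon}S_\mu$ with $D^2\phi(u_\epsilon)[w,w]<-\epsilon^{\alpha_1}\|w\|^2$ for all $w\in W\setminus\{0\}$, then $\dim W\le d$; and (1)-(4) hold for $-u_\epsilon$ in place of $u_\epsilon$ as well. -/

import Mathlib

open Set Topology

namespace ConstrainedMinimax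

section Setting

variable {E H : Type*} [NormedAddCommGroup E] [InnerProductSpace ℝ E]
  [NormedAddCommGroup H] [InnerProductSpace ℝ H]

/-- The constraint `S_μ = {u ∈ E : |u|² = μ}`, where `|·|` is the norm of `H` and `ι` is the
injection of `E` into `H`. -/
def massSphere (ι : E →L[ℝ] H) (μ : ℝ) : Set E :=
  {u | ‖ι u‖ ^ 2 = μ}

/-- The tangent space `T_u S_μ = {v ∈ E : (u, v) = 0}`, with `(·,·)` the inner product of `H`. -/
def tangentSpace (ι : E →L[ℝ] H) (u : E) : Submodule ℝ E where
  carrier := {v | inner ℝ (ι u) (ι v) = 0}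
  zero_mem' := by simp
  add_mem' := by
    intro a b ha hb
    change inner ℝ (ι u) (ι (a + b)) = 0
    change inner ℝ (ι u) (ι a) = 0 at ha
    change inner ℝ (ι u) (ι b) = 0 at hb
    rw [map_add, inner_add_right, ha, hb, add_zero]
  smul_mem' := by
    intro c a ha
    change inner ℝ (ι u) (ι (c • a)) = 0
    change inner ℝ (ι u) (ι a) = 0 at ha
    rw [map_smul, inner_smul_right, ha, mul_zero]

/-- The differential at `u` of `φ` restricted to the constraint, that is, the restriction of
`φ'(u)` to the tangent space at `u`, which carries the norm of `E`. -/
noncomputable def constrainedDeriv (ι : E →L[ℝ] H) (φ : E → ℝ) (u : E) :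
    tangentSpace ι u →L[ℝ] ℝ :=
  (fderiv ℝ φ u).comp (tangentSpace ι u).subtypeL

/-- The bilinear map `D²φ(u) = φ''(u) - (φ'(u)[u] / |u|²) (·,·)`. -/
noncomputable def constrainedHessian (ι : E →L[ℝ] H) (φ : E → ℝ) (u v w : E) : ℝ :=
  fderiv ℝ (fderiv ℝ φ) u v w - fderiv ℝ φ u u / ‖ι u‖ ^ 2 * inner ℝ (ι v) (ι w)

/-- `φ'` and `φ''` are `α`-Hölder continuous on bounded sets. -/
def HolderDerivsOnBounded (φ : E → ℝ) (α : ℝ) : Prop :=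
  ∀ r : ℝ, 0 < r → ∃ M : ℝ, 0 < M ∧ ∀ u₁ ∈ Metric.ball (0 : E) r, ∀ u₂ ∈ Metric.ball (0 : E) r,
    ‖fderiv ℝ φ u₁ - fderiv ℝ φ u₂‖ ≤ M * ‖u₁ - u₂‖ ^ α ∧
    ‖fderiv ℝ (fderiv ℝ φ) u₁ - fderiv ℝ (fderiv ℝ φ) u₂‖ ≤ M * ‖u₁ - u₂‖ ^ α

/-- `P` is an open subset of the constraint (in the relative topology) with `-P = P`. -/
structure IsSymmOpenIn (ι : E →L[ℝ] H) (μ : ℝ) (P : Set E) : Prop where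
  isOpen : ∃ U : Set E, IsOpen U ∧ P = massSphere ι μ ∩ U
  symm : ∀ u, -u ∈ P ↔ u ∈ P

/-- `V` is a pseudogradient field of `φ` constrained to `S_μ`: a tangent vector field, locally
Lipschitz off the constrained critical points, such that `‖V‖ ≤ a ‖φ'|‖` and `⟨φ', V⟩ ≥ b ‖φ'|‖²`
for some constants `a, b > 0`. Only the values of `V` on `S_μ` matter. -/
structure IsPseudogradient (ι : E →L[ℝ] H) (μ : ℝ) (φ : E → ℝ) (V : E → E) : Prop where
  tangent : ∀ u ∈ massSphere ι μ, V u ∈ tangentSpace ι u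
  locallyLipschitz :
    LocallyLipschitzOn {u | u ∈ massSphere ι μ ∧ constrainedDeriv ι φ u ≠ 0} V
  norm_le : ∃ a : ℝ, 0 < a ∧ ∀ u ∈ massSphere ι μ, ‖V u‖ ≤ a * ‖constrainedDeriv ι φ u‖
  descent : ∃ b : ℝ, 0 < b ∧ ∀ u ∈ massSphere ι μ,
    b * ‖constrainedDeriv ι φ u‖ ^ 2 ≤ fderiv ℝ φ u (V u)

/-- `S(r) = {u ∈ S_μ : dist(u, S) ≤ r}`, which is empty if `S` is. -/
def nbhd (ι : E →L[ℝ] H) (μ : ℝ) (S : Set E) (r : ℝ) : Set E :=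
  massSphere ι μ ∩ Metric.cthickening r S

/-- `{u ∈ S_μ : c - 2ε ≤ φ(u) ≤ c + 2ε}`. -/
def strip (ι : E →L[ℝ] H) (μ : ℝ) (φ : E → ℝ) (c ε : ℝ) : Set E :=
  {u | u ∈ massSphere ι μ ∧ c - 2 * ε ≤ φ u ∧ φ u ≤ c + 2 * ε}

/-- The data `S`, `c`, `ε`, `ξ` for which the flow-invariance condition provides a deformation
(`P = P*`, `Q = P**`). -/
structure IsDeformable (ι : E →L[ℝ] H) (μ : ℝ) (φ : E → ℝ) (V : E → E) (P Q : Set E) (R : ℝ)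
    (S : Set E) (c ε ξ : ℝ) : Prop where
  eps_pos : 0 < ε
  xi_pos : 0 < ξ
  subset : S ⊆ massSphere ι μ \ closure Q
  symm : ∀ u, -u ∈ S ↔ u ∈ S
  nbhd_subset : nbhd ι μ S (2 * ξ) ⊆ Metric.ball 0 R \ P
  le_norm : ∀ u ∈ strip ι μ φ c ε ∩ nbhd ι μ S (2 * ξ), u ∉ closure Q → 2 * ε / ξ ≤ ‖V u‖

/-- `η` is a deformation in `C([0,ξ] × S_μ, S_μ)`, odd in `u` and starting from the identity, with
the properties (i)-(iv) of the flow-invariance condition (`Q = P**`). Only the values of `η` on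
`[0,ξ] × S_μ` matter. -/
structure IsDeformation (ι : E →L[ℝ] H) (μ : ℝ) (φ : E → ℝ) (Q S : Set E) (c ε ξ : ℝ)
    (η : ℝ → E → E) : Prop where
  continuousOn : ContinuousOn (fun p : ℝ × E => η p.1 p.2) (Icc 0 ξ ×ˢ massSphere ι μ)
  mem : ∀ t ∈ Icc 0 ξ, ∀ u ∈ massSphere ι μ, η t u ∈ massSphere ι μ
  odd : ∀ t ∈ Icc 0 ξ, ∀ u ∈ massSphere ι μ, η t (-u) = -η t u
  zero : ∀ u ∈ massSphere ι μ, η 0 u = u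
  fixed : ∀ t ∈ Icc 0 ξ, ∀ u ∈ massSphere ι μ,
    u ∉ strip ι μ φ c ε ∩ nbhd ι μ S (2 * ξ) → η t u = u
  antitone : ∀ u ∈ massSphere ι μ, AntitoneOn (fun t => φ (η t u)) (Icc 0 ξ)
  invariant : ∀ t ∈ Icc 0 ξ, ∀ u ∈ closure Q, η t u ∈ closure Q
  descend : ∀ u ∈ S, φ u ≤ c + ε → η ξ u ∈ closure Q ∨ φ (η ξ u) ≤ c - ε

/-- Condition (A1) for `φ`, `R`, the pseudogradient `V` and the sets `P = P*`, `Q = P**`: for all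
deformable data there is a deformation. The deformation that it provides for the data `S`, `c`,
`ε`, `ξ` is named `η S c ε ξ`. -/
def FlowInvariance (ι : E →L[ℝ] H) (μ : ℝ) (φ : E → ℝ) (V : E → E) (P Q : Set E) (R : ℝ)
    (η : Set E → ℝ → ℝ → ℝ → ℝ → E → E) : Prop :=
  ∀ (S : Set E) (c ε ξ : ℝ), IsDeformable ι μ φ V P Q R S c ε ξ →
    IsDeformation ι μ φ Q S c ε ξ (η S c ε ξ)

/-- Condition (A2): the infimum of `‖V‖` over `B(S_μ;0,R) ∩ closure P** \ P*` is positive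
(`P = P*`, `Q = P**`; `closure Q ⊆ S_μ`). -/
def BoundedBelowOnCollar (V : E → E) (P Q : Set E) (R : ℝ) : Prop :=
  ∃ m : ℝ, 0 < m ∧ ∀ u ∈ (Metric.ball 0 R ∩ closure Q) \ P, m ≤ ‖V u‖

/-- `f` is (on `D`) a continuous map from `D` to `S_μ` with `f ∘ σ = -f`. -/
structure IsEquivariant (ι : E →L[ℝ] H) (μ : ℝ) {X : Type*} [TopologicalSpace X]
    (σ : X → X) (D : Set X) (f : X → E) : Prop where
  continuousOn : ContinuousOn f D
  mapsTo : MapsTo f D (massSphere ι μ)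
  equivariant : ∀ x ∈ D, f (σ x) = -f x

end Setting

end ConstrainedMinimax

/-! Suppose that `D²φ` at an almost critical point `f z` is below `-lam ‖·‖²` on a subspace `W` of
dimension larger than that of the parameter space. The differential of `φ`, restricted to `W` and
composed with `f`, can be approximated by a `C¹` map. The image of this map has measure zero, so it
omits `0` after a small shift. Normalizing gives a continuous field of unit vectors of `W` along
which the first-order term is at most an arbitrarily small `τ`, so a move of length `δ` along great
circles in the direction of this field lowers `φ` by about `δ² lam / 4`.

Such moves, cut off near the points `z` of a finite separated net and extended to the points `σ z`
by oddness, are carried out one after another. The number of moves that affect a given point is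
bounded by the Besicovitch constant of the parameter space, independently of the net, so `δ` can be
taken proportional to the radius `ρ` on which the second-order estimates hold. The Hölder condition
allows `ρ ^ α` proportional to `lam = ε ^ α₁`, and `α₁ ≤ α / (2 (α + 2))` makes the gain
`δ² lam / 4` larger than `4 ε`.

If every almost critical point of `f` had such a negative subspace, the modified map would have no
almost critical points off `closure Q` at levels close to `c`, and the deformation given by (A1)
would push it below the level `c`, against the minimax inequality. -/

namespace ConstrainedMinimax

section HolderCalculus

variable {E F G K : Type*} [NormedAddCommGroup E] [NormedAddCommGroup F] {α : ℝ} {s : Set E}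
  {f : E → F}

/-- `f` is bounded and `α`-Hölder continuous on `s`. One constant serves for both properties. -/
def IsBoundedHolderOn (α : ℝ) (s : Set E) (f : E → F) : Prop :=
  ∃ C, (∀ u ∈ s, ‖f u‖ ≤ C) ∧ ∀ u ∈ s, ∀ v ∈ s, ‖f u - f v‖ ≤ C * ‖u - v‖ ^ α

namespace IsBoundedHolderOn

theorem of_norm_le_of_holder {A B : ℝ} (hA : ∀ u ∈ s, ‖f u‖ ≤ A)
    (hB : ∀ u ∈ s, ∀ v ∈ s, ‖f u - f v‖ ≤ B * ‖u - v‖ ^ α) : IsBoundedHolderOn α s f :=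
  ⟨max A B, fun u hu => (hA u hu).trans (le_max_left _ _), fun u hu v hv => (hB u hu v hv).trans <|
    mul_le_mul_of_nonneg_right (le_max_right _ _) (by positivity)⟩

theorem const (c : F) : IsBoundedHolderOn α s fun _ => c :=
  ⟨‖c‖, fun _ _ => le_rfl, fun _ _ _ _ => by rw [sub_self, norm_zero]; positivity⟩

theorem mono {t : Set E} (hf : IsBoundedHolderOn α t f) (h : s ⊆ t) : IsBoundedHolderOn α s f :=
  hf.imp fun _ hC => ⟨fun u hu => hC.1 u (h hu), fun u hu v hv => hC.2 u (h hu) v (h hv)⟩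

theorem of_holder_ball {R M : ℝ} (hα : 0 ≤ α) (hR : 0 < R)
    (hf : ∀ u ∈ Metric.ball (0 : E) R, ∀ v ∈ Metric.ball (0 : E) R,
      ‖f u - f v‖ ≤ M * ‖u - v‖ ^ α) : IsBoundedHolderOn α (Metric.ball 0 R) f := by
  refine of_norm_le_of_holder (A := ‖f 0‖ + |M| * R ^ α) (fun u hu => ?_) hf
  calc ‖f u‖ ≤ ‖f 0‖ + ‖f u - f 0‖ := norm_le_insert' _ _
    _ ≤ ‖f 0‖ + M * ‖u - 0‖ ^ α := by gcongr; exact hf u hu 0 (Metric.mem_ball_self hR)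
    _ ≤ ‖f 0‖ + |M| * R ^ α := by
      rw [sub_zero]
      gcongr
      · exact le_abs_self M
      · exact (mem_ball_zero_iff.1 hu).le

theorem id_ball (R : ℝ) (hα₀ : 0 ≤ α) (hα₁ : α ≤ 1) :
    IsBoundedHolderOn α (Metric.ball 0 R) (fun u : E => u) := by
  refine of_norm_le_of_holder (A := R) (B := (R + R) ^ (1 - α))
    (fun u hu => (mem_ball_zero_iff.1 hu).le) fun u hu v hv => ?_
  rw [mem_ball_zero_iff] at hu hv
  calc ‖u - v‖ = ‖u - v‖ ^ (1 - α) * ‖u - v‖ ^ α := by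
        rw [← Real.rpow_add_of_nonneg (norm_nonneg _) (sub_nonneg.2 hα₁) hα₀, sub_add_cancel,
          Real.rpow_one]
    _ ≤ (R + R) ^ (1 - α) * ‖u - v‖ ^ α := by
      gcongr
      exact (norm_sub_le _ _).trans (add_le_add hu.le hv.le)

theorem sub {g : E → F} (hf : IsBoundedHolderOn α s f) (hg : IsBoundedHolderOn α s g) :
    IsBoundedHolderOn α s fun u => f u - g u := by
  obtain ⟨A, hA, hA'⟩ := hf
  obtain ⟨B, hB, hB'⟩ := hg
  refine ⟨A + B, fun u hu => norm_sub_le_of_le (hA u hu) (hB u hu), fun u hu v hv => ?_⟩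
  rw [sub_sub_sub_comm, add_mul]
  exact norm_sub_le_of_le (hA' u hu v hv) (hB' u hu v hv)

variable [NormedSpace ℝ F] [NormedAddCommGroup G] [NormedSpace ℝ G] [NormedAddCommGroup K]
  [NormedSpace ℝ K] {g : E → G}

theorem bilinear (hf : IsBoundedHolderOn α s f) (hg : IsBoundedHolderOn α s g)
    (L : F →L[ℝ] G →L[ℝ] K) : IsBoundedHolderOn α s fun u => L (f u) (g u) := by
  obtain ⟨A, hA, hA'⟩ := hf
  obtain ⟨B, hB, hB'⟩ := hg
  refine of_norm_le_of_holder (A := ‖L‖ * A * B) (B := ‖L‖ * A * B + ‖L‖ * A * B)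
    (fun u hu => L.le_of_opNorm₂_le_of_le le_rfl (hA u hu) (hB u hu)) fun u hu v hv => ?_
  calc ‖L (f u) (g u) - L (f v) (g v)‖ = ‖L (f u - f v) (g u) + L (f v) (g u - g v)‖ := by
        rw [map_sub, map_sub, sub_apply, sub_add_sub_cancel]
    _ ≤ ‖L‖ * (A * ‖u - v‖ ^ α) * B + ‖L‖ * A * (B * ‖u - v‖ ^ α) :=
        norm_add_le_of_le (L.le_of_opNorm₂_le_of_le le_rfl (hA' u hu v hv) (hB u hu))
          (L.le_of_opNorm₂_le_of_le le_rfl (hA v hv) (hB' u hu v hv))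
    _ = (‖L‖ * A * B + ‖L‖ * A * B) * ‖u - v‖ ^ α := by ring

theorem clm_comp (hf : IsBoundedHolderOn α s f) (L : F →L[ℝ] G) :
    IsBoundedHolderOn α s fun u => L (f u) :=
  (const L).bilinear hf (.id ℝ _)

end IsBoundedHolderOn

end HolderCalculus

section GreatCircle

variable {E : Type*} [NormedAddCommGroup E] [NormedSpace ℝ E] {κ : ℝ} {u p : E}

/-- The curve `cos (κ s) u + sin (κ s) κ⁻¹ p` with initial point `u` and initial velocity `p`. The
function `sinc` covers the case `κ = 0` and makes the curve continuous in its parameters. -/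
noncomputable def greatCircle (κ : ℝ) (u p : E) (s : ℝ) : E :=
  Real.cos (κ * s) • u + (s * Real.sinc (κ * s)) • p

/-- The velocity of the great circle `greatCircle κ u p`. -/
noncomputable def greatCircleVelocity (κ : ℝ) (u p : E) (s : ℝ) : E :=
  Real.cos (κ * s) • p - (κ * Real.sin (κ * s)) • u

@[simp]
theorem greatCircle_zero : greatCircle κ u p 0 = u := by simp [greatCircle]

@[simp]
theorem greatCircleVelocity_zero : greatCircleVelocity κ u p 0 = p := by
  simp [greatCircleVelocity]

theorem mul_mul_sinc_mul (κ s : ℝ) : κ * (s * Real.sinc (κ * s)) = Real.sin (κ * s) := by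
  rcases eq_or_ne (κ * s) 0 with h | h
  · rw [h, Real.sinc_zero, mul_one, h, Real.sin_zero]
  · rw [Real.sinc_of_ne_zero h, ← mul_assoc, mul_div_cancel₀ _ h]

theorem hasDerivAt_mul_sinc_mul (κ s : ℝ) :
    HasDerivAt (fun t => t * Real.sinc (κ * t)) (Real.cos (κ * s)) s := by
  rcases eq_or_ne κ 0 with rfl | hκ
  · simpa using hasDerivAt_id' s
  · have h : (fun t => t * Real.sinc (κ * t)) = fun t => Real.sin (κ * t) / κ := by
      ext t
      rw [← mul_mul_sinc_mul, mul_div_cancel_left₀ _ hκ]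
    rw [h]
    simpa [hκ] using (((hasDerivAt_id s).const_mul κ).sin).div_const κ

theorem hasDerivAt_greatCircle (s : ℝ) :
    HasDerivAt (greatCircle κ u p) (greatCircleVelocity κ u p s) s := by
  refine ((((hasDerivAt_id' s).const_mul κ).cos.smul_const u).add
    ((hasDerivAt_mul_sinc_mul κ s).smul_const p)).congr_deriv ?_
  rw [greatCircleVelocity]
  module

theorem hasDerivAt_greatCircleVelocity (s : ℝ) :
    HasDerivAt (greatCircleVelocity κ u p) (-(κ ^ 2 • greatCircle κ u p s)) s := by
  refine ((((hasDerivAt_id' s).const_mul κ).cos.smul_const p).sub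
    ((((hasDerivAt_id' s).const_mul κ).sin.const_mul κ).smul_const u)).congr_deriv ?_
  rw [greatCircle, ← mul_mul_sinc_mul κ s]
  module

theorem norm_greatCircleVelocity_le (s : ℝ) :
    ‖greatCircleVelocity κ u p s‖ ≤ ‖p‖ + |κ| * ‖u‖ := by
  refine norm_sub_le_of_le ?_ ?_
  · rw [norm_smul]
    exact mul_le_of_le_one_left (norm_nonneg _) (Real.abs_cos_le_one _)
  · rw [norm_smul, norm_mul, Real.norm_eq_abs]
    gcongr
    exact mul_le_of_le_one_right (abs_nonneg _) (Real.abs_sin_le_one _)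

theorem norm_greatCircle_sub_le (s : ℝ) :
    ‖greatCircle κ u p s - u‖ ≤ (‖p‖ + |κ| * ‖u‖) * |s| := by
  simpa using convex_univ.norm_image_sub_le_of_norm_hasDerivWithin_le
    (fun t _ => (hasDerivAt_greatCircle t).hasDerivWithinAt)
    (fun t _ => norm_greatCircleVelocity_le (κ := κ) (u := u) (p := p) t) (mem_univ 0) (mem_univ s)

theorem norm_sq_smul_greatCircle_le (s : ℝ) :
    ‖κ ^ 2 • greatCircle κ u p s‖ ≤ |κ| * (‖p‖ + |κ| * ‖u‖) := by
  have h : κ ^ 2 • greatCircle κ u p s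
      = κ • (Real.sin (κ * s) • p + (κ * Real.cos (κ * s)) • u) := by
    rw [greatCircle, ← mul_mul_sinc_mul]
    module
  rw [h, norm_smul, Real.norm_eq_abs]
  gcongr
  refine norm_add_le_of_le ?_ ?_
  · rw [norm_smul]
    exact mul_le_of_le_one_left (norm_nonneg _) (Real.abs_sin_le_one _)
  · rw [norm_smul, norm_mul, Real.norm_eq_abs]
    gcongr
    exact mul_le_of_le_one_right (abs_nonneg _) (Real.abs_cos_le_one _)

theorem norm_greatCircleVelocity_sub_le (s : ℝ) :
    ‖greatCircleVelocity κ u p s - p‖ ≤ |κ| * (‖p‖ + |κ| * ‖u‖) * |s| := by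
  simpa using convex_univ.norm_image_sub_le_of_norm_hasDerivWithin_le
    (fun t _ => (hasDerivAt_greatCircleVelocity t).hasDerivWithinAt)
    (fun t _ => (norm_neg _).trans_le (norm_sq_smul_greatCircle_le (κ := κ) (u := u) (p := p) t))
    (mem_univ 0) (mem_univ s)

end GreatCircle

theorem le_of_deriv_deriv_le {h h' h'' : ℝ → ℝ} {M s : ℝ} (hs : 0 ≤ s)
    (hh : ∀ t, HasDerivAt h (h' t) t) (hh' : ∀ t, HasDerivAt h' (h'' t) t)
    (hM : ∀ t ∈ Icc 0 s, h'' t ≤ M) : h s ≤ h 0 + s * h' 0 + M * s ^ 2 / 2 := by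
  have hfirst : ∀ t ∈ Icc 0 s, h' t ≤ h' 0 + M * t :=
    image_le_of_deriv_right_le_deriv_boundary
      (continuous_iff_continuousAt.2 fun t => (hh' t).continuousAt).continuousOn
      (fun t _ => (hh' t).hasDerivWithinAt) (by simp) (by fun_prop)
      (fun t _ => (((hasDerivAt_id t).const_mul M).const_add (h' 0)).hasDerivWithinAt)
      (fun t ht => by simpa using hM t (Ico_subset_Icc_self ht))
  have hB : ∀ t, HasDerivAt (fun t => h 0 + t * h' 0 + M * t ^ 2 / 2) (h' 0 + M * t) t := by
    intro t
    refine ((((hasDerivAt_id' t).mul_const (h' 0)).const_add (h 0)).add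
      ((((hasDerivAt_id' t).pow 2).const_mul M).div_const 2)).congr_deriv ?_
    push_cast
    ring
  exact image_le_of_deriv_right_le_deriv_boundary
    (continuous_iff_continuousAt.2 fun t => (hh t).continuousAt).continuousOn
    (fun t _ => (hh t).hasDerivWithinAt) (by simp) (by fun_prop)
    (fun t _ => (hB t).hasDerivWithinAt) (fun t ht => hfirst t (Ico_subset_Icc_self ht))
    (right_mem_Icc.2 hs)

section Sphere

variable {E H : Type*} [NormedAddCommGroup E] [InnerProductSpace ℝ E]
  [NormedAddCommGroup H] [InnerProductSpace ℝ H] {ι : E →L[ℝ] H} {κ : ℝ} {u p : E} {φ : E → ℝ}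

theorem mem_tangentSpace : p ∈ tangentSpace ι u ↔ inner ℝ (ι u) (ι p) = 0 := Iff.rfl

theorem norm_map_greatCircle (hp : p ∈ tangentSpace ι u) (hκ : |κ| * ‖ι u‖ = ‖ι p‖) (s : ℝ) :
    ‖ι (greatCircle κ u p s)‖ = ‖ι u‖ := by
  have hsq : ‖ι p‖ ^ 2 = κ ^ 2 * ‖ι u‖ ^ 2 := by rw [← hκ, mul_pow, sq_abs]
  rw [← sq_eq_sq₀ (norm_nonneg _) (norm_nonneg _), greatCircle, map_add, map_smul, map_smul,
    norm_add_sq_real, norm_smul, norm_smul, inner_smul_left, inner_smul_right,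
    mem_tangentSpace.1 hp, mul_pow, mul_pow, hsq, Real.norm_eq_abs, Real.norm_eq_abs, sq_abs,
    sq_abs]
  linear_combination ‖ι u‖ ^ 2 * (Real.sin_sq_add_cos_sq (κ * s)) +
    ‖ι u‖ ^ 2 * (κ * (s * Real.sinc (κ * s)) + Real.sin (κ * s)) * mul_mul_sinc_mul κ s

theorem norm_map_greatCircleVelocity (hp : p ∈ tangentSpace ι u) (hκ : |κ| * ‖ι u‖ = ‖ι p‖)
    (s : ℝ) : ‖ι (greatCircleVelocity κ u p s)‖ = ‖ι p‖ := by
  have hsq : ‖ι p‖ ^ 2 = κ ^ 2 * ‖ι u‖ ^ 2 := by rw [← hκ, mul_pow, sq_abs]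
  rw [← sq_eq_sq₀ (norm_nonneg _) (norm_nonneg _), greatCircleVelocity, map_sub, map_smul, map_smul,
    norm_sub_sq_real, norm_smul, norm_smul, inner_smul_left, inner_smul_right, real_inner_comm,
    mem_tangentSpace.1 hp, mul_pow, mul_pow, hsq, Real.norm_eq_abs, Real.norm_eq_abs, sq_abs,
    sq_abs]
  linear_combination κ ^ 2 * ‖ι u‖ ^ 2 * (Real.sin_sq_add_cos_sq (κ * s))

theorem hasDerivAt_fderiv_greatCircle (hφ : ContDiff ℝ 2 φ) (hu : ι u ≠ 0)
    (hp : p ∈ tangentSpace ι u) (hκ : |κ| * ‖ι u‖ = ‖ι p‖) (s : ℝ) :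
    HasDerivAt (fun t => fderiv ℝ φ (greatCircle κ u p t) (greatCircleVelocity κ u p t))
      (constrainedHessian ι φ (greatCircle κ u p s) (greatCircleVelocity κ u p s)
        (greatCircleVelocity κ u p s)) s := by
  have hφ' : Differentiable ℝ (fderiv ℝ φ) :=
    (hφ.fderiv_right (m := 1) (by norm_num)).differentiable one_ne_zero
  refine (((hφ' _).hasFDerivAt.comp_hasDerivAt s (hasDerivAt_greatCircle s)).clm_apply
    (hasDerivAt_greatCircleVelocity s)).congr_deriv ?_
  have hκ2 : κ ^ 2 = ‖ι p‖ ^ 2 / ‖ι u‖ ^ 2 := by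
    rw [← hκ, mul_pow, sq_abs, mul_div_cancel_right₀ _ (by simpa using hu)]
  rw [constrainedHessian, real_inner_self_eq_norm_sq, norm_map_greatCircle hp hκ,
    norm_map_greatCircleVelocity hp hκ, map_neg, map_smul, hκ2, smul_eq_mul]
  simp only [Function.comp_apply]
  ring

theorem apply_greatCircle_le (hφ : ContDiff ℝ 2 φ) (hu : ι u ≠ 0)
    (hp : p ∈ tangentSpace ι u) (hκ : |κ| * ‖ι u‖ = ‖ι p‖) {M s : ℝ} (hs : 0 ≤ s)
    (hM : ∀ t ∈ Icc 0 s, constrainedHessian ι φ (greatCircle κ u p t)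
      (greatCircleVelocity κ u p t) (greatCircleVelocity κ u p t) ≤ M) :
    φ (greatCircle κ u p s) ≤ φ u + s * fderiv ℝ φ u p + M * s ^ 2 / 2 := by
  simpa using le_of_deriv_deriv_le hs
    (fun t => ((hφ.differentiable two_ne_zero) _).hasFDerivAt.comp_hasDerivAt t
      (hasDerivAt_greatCircle t)) (hasDerivAt_fderiv_greatCircle hφ hu hp hκ) hM

end Sphere

section TangentProj

variable {E H : Type*} [NormedAddCommGroup E] [InnerProductSpace ℝ E]
  [NormedAddCommGroup H] [InnerProductSpace ℝ H] {ι : E →L[ℝ] H} {μ : ℝ} {φ : E → ℝ} {u v w : E}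
  {α R : ℝ}

/-- The inner product of `H`, as a continuous bilinear form on `E`. -/
noncomputable def massForm (ι : E →L[ℝ] H) : E →L[ℝ] E →L[ℝ] ℝ :=
  (isBoundedBilinearMap_inner (𝕜 := ℝ) (E := H)).toContinuousLinearMap.bilinearComp ι ι

@[simp]
theorem massForm_apply : massForm ι v w = inner ℝ (ι v) (ι w) := rfl

/-- The projection `w ↦ w - ((u, w) / μ) u` of `E` onto the tangent space at `u ∈ S_μ`, which is
orthogonal for the inner product of `H`. -/
noncomputable def tangentProj (ι : E →L[ℝ] H) (μ : ℝ) (u : E) : E →L[ℝ] E :=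
  .id ℝ E - μ⁻¹ • (massForm ι u).smulRight u

theorem tangentProj_apply : tangentProj ι μ u w = w - (μ⁻¹ * inner ℝ (ι u) (ι w)) • u := by
  simp [tangentProj, mul_smul]

theorem neg_mem_massSphere : -u ∈ massSphere ι μ ↔ u ∈ massSphere ι μ := by
  simp only [massSphere, mem_ofPred_eq, map_neg, norm_neg]

theorem tangentProj_mem (hμ : μ ≠ 0) (hu : u ∈ massSphere ι μ) (w : E) :
    tangentProj ι μ u w ∈ tangentSpace ι u := by
  have hu' : ‖ι u‖ ^ 2 = μ := hu
  rw [mem_tangentSpace, tangentProj_apply, map_sub, map_smul, inner_sub_right, inner_smul_right,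
    real_inner_self_eq_norm_sq, hu']
  field_simp
  ring

theorem tangentProj_of_mem (hw : w ∈ tangentSpace ι u) : tangentProj ι μ u w = w := by
  rw [tangentProj_apply, mem_tangentSpace.1 hw, mul_zero, zero_smul, sub_zero]

theorem IsBoundedHolderOn.tangentProj (R : ℝ) (hα₀ : 0 ≤ α) (hα₁ : α ≤ 1) :
    IsBoundedHolderOn α (Metric.ball 0 R) (tangentProj ι μ) :=
  (const _).sub <| (((id_ball R hα₀ hα₁).clm_comp (massForm ι)).bilinear (id_ball R hα₀ hα₁)
    (ContinuousLinearMap.smulRightL ℝ E E)).clm_comp (μ⁻¹ • .id ℝ _)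

/-- The bilinear form `D²φ(u)` on `S_μ`, with `|u|²` replaced by `μ`. -/
noncomputable def constrainedHessianForm (ι : E →L[ℝ] H) (μ : ℝ) (φ : E → ℝ) (u : E) :
    E →L[ℝ] E →L[ℝ] ℝ :=
  fderiv ℝ (fderiv ℝ φ) u - (fderiv ℝ φ u u) • μ⁻¹ • massForm ι

theorem constrainedHessianForm_apply (hu : u ∈ massSphere ι μ) :
    constrainedHessianForm ι μ φ u v w = constrainedHessian ι φ u v w := by
  have hu' : ‖ι u‖ ^ 2 = μ := hu
  simp [constrainedHessianForm, constrainedHessian, hu', div_eq_mul_inv, mul_assoc]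

theorem IsBoundedHolderOn.constrainedHessianForm (hα₀ : 0 ≤ α) (hα₁ : α ≤ 1)
    (hφ' : IsBoundedHolderOn α (Metric.ball 0 R) (fderiv ℝ φ))
    (hφ'' : IsBoundedHolderOn α (Metric.ball 0 R) (fderiv ℝ (fderiv ℝ φ))) :
    IsBoundedHolderOn α (Metric.ball 0 R) (constrainedHessianForm ι μ φ) :=
  hφ''.sub <| (hφ'.bilinear (id_ball R hα₀ hα₁) (.id ℝ _)).clm_comp
    (.toSpanSingleton ℝ (μ⁻¹ • massForm ι))

theorem norm_constrainedDeriv_le_norm_fderiv :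
    ‖constrainedDeriv ι φ u‖ ≤ ‖fderiv ℝ φ u‖ :=
  ((fderiv ℝ φ u).opNorm_comp_le _).trans <|
    mul_le_of_le_one_right (norm_nonneg _) (Submodule.norm_subtypeL_le _)

theorem norm_constrainedDeriv_le (hμ : μ ≠ 0) (hv : v ∈ massSphere ι μ) :
    ‖constrainedDeriv ι φ u‖ ≤
      ‖constrainedDeriv ι φ v‖ * (1 + ‖tangentProj ι μ u - tangentProj ι μ v‖) +
        ‖(fderiv ℝ φ u).comp (tangentProj ι μ u) - (fderiv ℝ φ v).comp (tangentProj ι μ v)‖ := by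
  refine ContinuousLinearMap.opNorm_le_bound _ (by positivity) fun w => ?_
  have hproj : tangentProj ι μ u (w : E) = w := tangentProj_of_mem w.2
  have hnorm : ‖tangentProj ι μ v w‖ ≤ (1 + ‖tangentProj ι μ u - tangentProj ι μ v‖) * ‖w‖ :=
    calc ‖tangentProj ι μ v w‖
        = ‖(w : E) - (tangentProj ι μ u - tangentProj ι μ v) w‖ := by simp [hproj]
      _ ≤ ‖w‖ + ‖tangentProj ι μ u - tangentProj ι μ v‖ * ‖w‖ :=
        norm_sub_le_of_le le_rfl (ContinuousLinearMap.le_opNorm _ _)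
      _ = _ := by ring
  calc ‖constrainedDeriv ι φ u w‖
      = ‖constrainedDeriv ι φ v ⟨tangentProj ι μ v w, tangentProj_mem hμ hv w⟩ +
          ((fderiv ℝ φ u).comp (tangentProj ι μ u) -
            (fderiv ℝ φ v).comp (tangentProj ι μ v)) w‖ := by
        simp [constrainedDeriv, hproj]
    _ ≤ ‖constrainedDeriv ι φ v‖ * ((1 + ‖tangentProj ι μ u - tangentProj ι μ v‖) * ‖w‖) +
          ‖(fderiv ℝ φ u).comp (tangentProj ι μ u) -
            (fderiv ℝ φ v).comp (tangentProj ι μ v)‖ * ‖w‖ :=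
        norm_add_le_of_le ((constrainedDeriv ι φ v).le_of_opNorm_le_of_le le_rfl hnorm)
          (ContinuousLinearMap.le_opNorm _ _)
    _ = _ := by ring

theorem exists_norm_constrainedDeriv_le_add (hα₀ : 0 ≤ α) (hα₁ : α ≤ 1) (hμ : μ ≠ 0)
    (hφ' : IsBoundedHolderOn α (Metric.ball 0 R) (fderiv ℝ φ)) :
    ∃ K, ∀ u ∈ Metric.ball 0 R, ∀ v ∈ massSphere ι μ ∩ Metric.ball 0 R,
      ‖constrainedDeriv ι φ u‖ ≤ ‖constrainedDeriv ι φ v‖ + K * ‖u - v‖ ^ α := by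
  have hproj := IsBoundedHolderOn.tangentProj (ι := ι) (μ := μ) R hα₀ hα₁
  obtain ⟨B, -, hB⟩ := hφ'.bilinear hproj (ContinuousLinearMap.compL ℝ E E ℝ)
  obtain ⟨A, hA, -⟩ := hφ'
  obtain ⟨N, -, hN⟩ := hproj
  refine ⟨A * N + B, fun u hu v hv => ?_⟩
  have hAN : ‖constrainedDeriv ι φ v‖ * ‖tangentProj ι μ u - tangentProj ι μ v‖ ≤
      A * (N * ‖u - v‖ ^ α) :=
    mul_le_mul (norm_constrainedDeriv_le_norm_fderiv.trans (hA v hv.2)) (hN u hu v hv.2)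
      (norm_nonneg _) ((norm_nonneg _).trans (hA v hv.2))
  have := norm_constrainedDeriv_le (φ := φ) (u := u) hμ hv.1
  have hB' : ‖(fderiv ℝ φ u).comp (tangentProj ι μ u) -
      (fderiv ℝ φ v).comp (tangentProj ι μ v)‖ ≤ B * ‖u - v‖ ^ α := hB u hu v hv.2
  linarith

end TangentProj

section SphereMove

variable {E H : Type*} [NormedAddCommGroup E] [InnerProductSpace ℝ E]
  [NormedAddCommGroup H] [InnerProductSpace ℝ H] {ι : E →L[ℝ] H} {μ : ℝ} {φ : E → ℝ} {u v w : E}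
  {α R : ℝ}

/-- The point reached at time `s` on the great circle of `S_μ` that leaves `u` with the tangential
part of `w` as velocity. The angular speed keeps the circle on `S_μ`. -/
noncomputable def sphereMove (ι : E →L[ℝ] H) (μ : ℝ) (u w : E) : ℝ → E :=
  greatCircle (‖ι (tangentProj ι μ u w)‖ / √μ) u (tangentProj ι μ u w)

/-- The velocity of the curve `sphereMove ι μ u w`. -/
noncomputable def sphereMoveVelocity (ι : E →L[ℝ] H) (μ : ℝ) (u w : E) : ℝ → E :=
  greatCircleVelocity (‖ι (tangentProj ι μ u w)‖ / √μ) u (tangentProj ι μ u w)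

@[simp]
theorem sphereMove_zero : sphereMove ι μ u w 0 = u := greatCircle_zero

theorem norm_map_of_mem_massSphere (hu : u ∈ massSphere ι μ) : ‖ι u‖ = √μ := by
  rw [← show ‖ι u‖ ^ 2 = μ from hu, Real.sqrt_sq (norm_nonneg _)]

theorem map_ne_zero_of_mem_massSphere (hμ : 0 < μ) (hu : u ∈ massSphere ι μ) : ι u ≠ 0 :=
  norm_pos_iff.1 <| norm_map_of_mem_massSphere hu ▸ Real.sqrt_pos.2 hμ

theorem abs_angularSpeed_mul_norm_map (hμ : 0 < μ) (hu : u ∈ massSphere ι μ) (p : E) :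
    |‖ι p‖ / √μ| * ‖ι u‖ = ‖ι p‖ := by
  rw [norm_map_of_mem_massSphere hu, abs_of_nonneg (by positivity),
    div_mul_cancel₀ _ (Real.sqrt_pos.2 hμ).ne']

theorem sphereMove_mem (hμ : 0 < μ) (hu : u ∈ massSphere ι μ) (w : E) (s : ℝ) :
    sphereMove ι μ u w s ∈ massSphere ι μ :=
  (congrArg (· ^ 2) (norm_map_greatCircle (tangentProj_mem hμ.ne' hu w)
    (abs_angularSpeed_mul_norm_map hμ hu _) s)).trans hu

theorem continuousOn_sphereMove {X : Type*} [TopologicalSpace X] {D : Set X} {f g : X → E}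
    {s : X → ℝ} (hf : ContinuousOn f D) (hg : ContinuousOn g D) (hs : ContinuousOn s D) :
    ContinuousOn (fun x => sphereMove ι μ (f x) (g x) (s x)) D := by
  have := Real.continuous_sinc
  unfold sphereMove greatCircle
  simp only [tangentProj_apply]
  fun_prop

theorem hasDerivAt_sphereMove_zero :
    HasDerivAt (sphereMove ι μ u w) (tangentProj ι μ u w) 0 :=
  (hasDerivAt_greatCircle 0).congr_deriv greatCircleVelocity_zero

theorem apply_sphereMove_le (hμ : 0 < μ) (hφ : ContDiff ℝ 2 φ) (hu : u ∈ massSphere ι μ)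
    {M s : ℝ} (hs : 0 ≤ s) (hM : ∀ t ∈ Icc 0 s, constrainedHessian ι φ (sphereMove ι μ u w t)
      (sphereMoveVelocity ι μ u w t) (sphereMoveVelocity ι μ u w t) ≤ M) :
    φ (sphereMove ι μ u w s) ≤ φ u + s * fderiv ℝ φ u (tangentProj ι μ u w) + M * s ^ 2 / 2 :=
  apply_greatCircle_le hφ (map_ne_zero_of_mem_massSphere hμ hu) (tangentProj_mem hμ.ne' hu w)
    (abs_angularSpeed_mul_norm_map hμ hu _) hs hM

theorem fderiv_neg_of_even (hμ : 0 < μ) (hφ : Differentiable ℝ φ)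
    (heven : ∀ u ∈ massSphere ι μ, φ (-u) = φ u) (hu : u ∈ massSphere ι μ)
    (hw : w ∈ tangentSpace ι u) : fderiv ℝ φ (-u) w = -fderiv ℝ φ u w := by
  have hcurve := hasDerivAt_sphereMove_zero (ι := ι) (μ := μ) (u := u) (w := w)
  rw [tangentProj_of_mem hw] at hcurve
  have h₁ : HasDerivAt (fun s => φ (sphereMove ι μ u w s)) (fderiv ℝ φ u w) 0 := by
    have := (hφ (sphereMove ι μ u w 0)).hasFDerivAt.comp_hasDerivAt 0 hcurve
    rwa [sphereMove_zero] at this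
  have h₂ : HasDerivAt (fun s => φ (-sphereMove ι μ u w s)) (fderiv ℝ φ (-u) (-w)) 0 := by
    have := (hφ (-sphereMove ι μ u w 0)).hasFDerivAt.comp_hasDerivAt 0 hcurve.neg
    rwa [sphereMove_zero] at this
  simp only [heven _ (sphereMove_mem hμ hu w _), map_neg] at h₂
  rw [h₁.unique h₂, neg_neg]

theorem norm_constrainedDeriv_neg_le (hμ : 0 < μ) (hφ : Differentiable ℝ φ)
    (heven : ∀ u ∈ massSphere ι μ, φ (-u) = φ u) (hu : u ∈ massSphere ι μ) :
    ‖constrainedDeriv ι φ (-u)‖ ≤ ‖constrainedDeriv ι φ u‖ := by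
  refine ContinuousLinearMap.opNorm_le_bound _ (by positivity) fun w => ?_
  have hw : (w : E) ∈ tangentSpace ι u := by
    simpa only [mem_tangentSpace, map_neg, inner_neg_left, neg_eq_zero] using w.2
  calc ‖constrainedDeriv ι φ (-u) w‖ = ‖constrainedDeriv ι φ u ⟨w, hw⟩‖ := by
        rw [← norm_neg]
        exact congrArg norm (neg_eq_iff_eq_neg.2 (fderiv_neg_of_even hμ hφ heven hu hw))
    _ ≤ ‖constrainedDeriv ι φ u‖ * ‖w‖ := ContinuousLinearMap.le_opNorm _ _

theorem norm_constrainedDeriv_neg (hμ : 0 < μ) (hφ : Differentiable ℝ φ)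
    (heven : ∀ u ∈ massSphere ι μ, φ (-u) = φ u) (hu : u ∈ massSphere ι μ) :
    ‖constrainedDeriv ι φ (-u)‖ = ‖constrainedDeriv ι φ u‖ :=
  (norm_constrainedDeriv_neg_le hμ hφ heven hu).antisymm <| by
    have := norm_constrainedDeriv_neg_le hμ hφ heven (neg_mem_massSphere.2 hu)
    rwa [neg_neg] at this

theorem exists_norm_sphereMove_sub_le (ι : E →L[ℝ] H) (μ : ℝ) (R : ℝ) :
    ∃ K, 1 ≤ K ∧ ∀ u ∈ Metric.ball (0 : E) R, ∀ w, ‖w‖ = 1 → ∀ s,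
      ‖sphereMove ι μ u w s - u‖ ≤ K * |s| ∧ ‖sphereMoveVelocity ι μ u w s‖ ≤ K ∧
        ‖sphereMoveVelocity ι μ u w s - tangentProj ι μ u w‖ ≤ K * |s| := by
  obtain ⟨N, hN, -⟩ := IsBoundedHolderOn.tangentProj (ι := ι) (μ := μ) R zero_le_one le_rfl
  set k := ‖ι‖ * N / √μ
  refine ⟨max (max 1 (N + k * R)) (k * (N + k * R)), le_max_of_le_left (le_max_left _ _),
    fun u hu w hw s => ?_⟩
  have hN₀ : 0 ≤ N := (norm_nonneg _).trans (hN u hu)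
  have hp : ‖tangentProj ι μ u w‖ ≤ N := by
    simpa [hw] using (tangentProj ι μ u).le_of_opNorm_le (hN u hu) w
  have hκ : |‖ι (tangentProj ι μ u w)‖ / √μ| ≤ k := by
    rw [abs_of_nonneg (by positivity)]
    exact div_le_div_of_nonneg_right (ι.le_of_opNorm_le_of_le le_rfl hp) (Real.sqrt_nonneg μ)
  have hspeed : ‖tangentProj ι μ u w‖ + |‖ι (tangentProj ι μ u w)‖ / √μ| * ‖u‖ ≤ N + k * R := by
    gcongr
    exact (mem_ball_zero_iff.1 hu).le
  refine ⟨(norm_greatCircle_sub_le s).trans ?_, (norm_greatCircleVelocity_le s).trans ?_,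
    (norm_greatCircleVelocity_sub_le s).trans ?_⟩
  · gcongr
    exact hspeed.trans (le_max_of_le_left (le_max_right _ _))
  · exact hspeed.trans (le_max_of_le_left (le_max_right _ _))
  · refine mul_le_mul_of_nonneg_right (le_max_of_le_right ?_) (abs_nonneg s)
    gcongr

theorem exists_norm_sphereMoveVelocity_sub_le (ι : E →L[ℝ] H) (μ R : ℝ) (hα₀ : 0 ≤ α)
    (hα₁ : α ≤ 1) :
    ∃ K, 1 ≤ K ∧ ∀ u ∈ Metric.ball (0 : E) R, ∀ u₀ ∈ Metric.ball (0 : E) R,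
      ∀ w ∈ tangentSpace ι u₀, ‖w‖ = 1 → ∀ s,
        ‖sphereMove ι μ u w s - u‖ ≤ K * |s| ∧ ‖sphereMoveVelocity ι μ u w s‖ ≤ K ∧
          ‖sphereMoveVelocity ι μ u w s - w‖ ≤ K * (|s| + ‖u - u₀‖ ^ α) := by
  obtain ⟨L, hL₁, hL⟩ := exists_norm_sphereMove_sub_le ι μ R
  obtain ⟨N, -, hN⟩ := IsBoundedHolderOn.tangentProj (ι := ι) (μ := μ) R hα₀ hα₁
  refine ⟨max L N, le_max_of_le_left hL₁, fun u hu u₀ hu₀ w hw hw₁ s => ?_⟩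
  obtain ⟨hmove, hvel, hvel'⟩ := hL u hu w hw₁ s
  have hproj : ‖tangentProj ι μ u w - w‖ ≤ N * ‖u - u₀‖ ^ α := by
    simpa [hw₁, tangentProj_of_mem hw] using
      (tangentProj ι μ u - tangentProj ι μ u₀).le_of_opNorm_le (hN u hu u₀ hu₀) w
  refine ⟨hmove.trans (by gcongr; exact le_max_left _ _), hvel.trans (le_max_left _ _), ?_⟩
  calc _ ≤ L * |s| + N * ‖u - u₀‖ ^ α :=
        (norm_sub_le_norm_sub_add_norm_sub _ (tangentProj ι μ u w) _).trans (add_le_add hvel' hproj)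
    _ ≤ max L N * |s| + max L N * ‖u - u₀‖ ^ α := by
      gcongr
      · exact le_max_left _ _
      · exact le_max_right _ _
    _ = _ := (mul_add _ _ _).symm

end SphereMove

section Descent

variable {E H : Type*} [NormedAddCommGroup E] [InnerProductSpace ℝ E]
  [NormedAddCommGroup H] [InnerProductSpace ℝ H] {ι : E →L[ℝ] H} {μ : ℝ} {φ : E → ℝ} {u₀ : E}
  {α R : ℝ}

theorem apply_apply_self_sub_le {A B : E →L[ℝ] E →L[ℝ] ℝ} (a b : E) :
    A a a - B b b ≤ ‖A - B‖ * ‖a‖ * ‖a‖ + ‖B‖ * (‖a‖ + ‖b‖) * ‖a - b‖ := by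
  have h : A a a - B b b = (A - B) a a + (B a (a - b) + B (a - b) b) := by
    simp only [sub_apply, map_sub]
    ring
  rw [h]
  have h₁ := (le_abs_self _).trans ((A - B).le_opNorm₂ a a)
  have h₂ := (le_abs_self _).trans (B.le_opNorm₂ a (a - b))
  have h₃ := (le_abs_self _).trans (B.le_opNorm₂ (a - b) b)
  linarith

theorem exists_constrainedHessian_le (hα₀ : 0 ≤ α) (hα₁ : α ≤ 1)
    (hφ' : IsBoundedHolderOn α (Metric.ball 0 R) (fderiv ℝ φ))
    (hφ'' : IsBoundedHolderOn α (Metric.ball 0 R) (fderiv ℝ (fderiv ℝ φ))) (L : ℝ) :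
    ∃ K, ∀ u ∈ massSphere ι μ ∩ Metric.ball 0 R, ∀ u₀ ∈ massSphere ι μ ∩ Metric.ball 0 R,
      ∀ v w, ‖v‖ ≤ L → ‖w‖ ≤ L →
        constrainedHessian ι φ u v v ≤
          constrainedHessian ι φ u₀ w w + K * (‖u - u₀‖ ^ α + ‖v - w‖) := by
  obtain ⟨C, hC, hC'⟩ := IsBoundedHolderOn.constrainedHessianForm (ι := ι) (μ := μ) hα₀ hα₁ hφ' hφ''
  refine ⟨C * L * L + C * (L + L), fun u hu u₀ hu₀ v w hv hw => ?_⟩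
  have hC₀ : 0 ≤ C := le_trans (by positivity) (hC u hu.2)
  have hL₀ : 0 ≤ L := (norm_nonneg v).trans hv
  rw [← constrainedHessianForm_apply hu.1, ← constrainedHessianForm_apply hu₀.1,
    ← sub_le_iff_le_add']
  calc _ ≤ _ := apply_apply_self_sub_le v w
    _ ≤ C * ‖u - u₀‖ ^ α * L * L + C * (L + L) * ‖v - w‖ := by
      gcongr
      · exact hC' u hu.2 u₀ hu₀.2
      · exact hC u₀ hu₀.2
    _ ≤ (C * L * L + C * (L + L)) * (‖u - u₀‖ ^ α + ‖v - w‖) := by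
      have h₁ : 0 ≤ C * (L + L) * ‖u - u₀‖ ^ α := by positivity
      have h₂ : 0 ≤ C * L * L * ‖v - w‖ := by positivity
      linarith

theorem exists_constrainedHessian_sphereMove_le (hμ : 0 < μ) (hα₀ : 0 ≤ α) (hα₁ : α ≤ 1)
    (hφ' : IsBoundedHolderOn α (Metric.ball 0 R) (fderiv ℝ φ))
    (hφ'' : IsBoundedHolderOn α (Metric.ball 0 R) (fderiv ℝ (fderiv ℝ φ))) :
    ∃ K, 1 ≤ K ∧ ∀ u₀ ∈ massSphere ι μ, ∀ ρ ≤ 1, ‖u₀‖ + 2 * ρ < R →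
      ∀ u ∈ massSphere ι μ, ‖u - u₀‖ ≤ ρ → ∀ w ∈ tangentSpace ι u₀, ‖w‖ = 1 →
      ∀ t, K * |t| ≤ ρ → ‖sphereMove ι μ u w t - u‖ ≤ K * |t| ∧
        constrainedHessian ι φ (sphereMove ι μ u w t) (sphereMoveVelocity ι μ u w t)
          (sphereMoveVelocity ι μ u w t) ≤ constrainedHessian ι φ u₀ w w + K * ρ ^ α := by
  obtain ⟨L, hL₁, hL⟩ := exists_norm_sphereMoveVelocity_sub_le ι μ R hα₀ hα₁
  obtain ⟨C, hC⟩ := exists_constrainedHessian_le (ι := ι) (μ := μ) hα₀ hα₁ hφ' hφ'' L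
  refine ⟨max L (|C| * (2 ^ α + (1 + L))), le_max_of_le_left hL₁,
    fun u₀ hu₀ ρ hρ₁ hρR u hu hρ w hw hw₁ t ht => ?_⟩
  have hρ₀ : 0 ≤ ρ := (norm_nonneg _).trans hρ
  have hρα : ρ ≤ ρ ^ α := by
    simpa using Real.rpow_le_rpow_of_exponent_ge' hρ₀ hρ₁ hα₀ hα₁
  have hu₀R : u₀ ∈ Metric.ball 0 R := mem_ball_zero_iff.2 (by linarith)
  have huR : u ∈ Metric.ball 0 R :=
    mem_ball_zero_iff.2 (by linarith [norm_le_norm_add_norm_sub' u u₀])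
  obtain ⟨hγ, hv, hvw⟩ := hL u huR u₀ hu₀R w hw hw₁ t
  have hLt : L * |t| ≤ max L (|C| * (2 ^ α + (1 + L))) * |t| := by gcongr; exact le_max_left _ _
  refine ⟨hγ.trans hLt, ?_⟩
  have hγu₀ : ‖sphereMove ι μ u w t - u₀‖ ≤ 2 * ρ := by
    linarith [norm_sub_le_norm_sub_add_norm_sub (sphereMove ι μ u w t) u u₀]
  have hγR : sphereMove ι μ u w t ∈ Metric.ball 0 R :=
    mem_ball_zero_iff.2 (by linarith [norm_le_norm_add_norm_sub' (sphereMove ι μ u w t) u₀])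
  calc _ ≤ constrainedHessian ι φ u₀ w w + C * (‖sphereMove ι μ u w t - u₀‖ ^ α +
        ‖sphereMoveVelocity ι μ u w t - w‖) :=
      hC _ ⟨sphereMove_mem hμ hu w t, hγR⟩ u₀ ⟨hu₀, hu₀R⟩ _ w hv (by linarith)
    _ ≤ constrainedHessian ι φ u₀ w w + |C| * ((2 * ρ) ^ α + (ρ ^ α + L * ρ ^ α)) := by
      gcongr
      · exact le_abs_self C
      · rw [mul_add] at hvw
        exact hvw.trans (add_le_add (by linarith) (by gcongr))
    _ = constrainedHessian ι φ u₀ w w + |C| * (2 ^ α + (1 + L)) * ρ ^ α := by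
      rw [Real.mul_rpow zero_le_two hρ₀]
      ring
    _ ≤ _ := by
      gcongr
      exact le_max_right _ _

/-- From each point near `u₀`, the moves along unit vectors of `W` for a time at most `δ` have speed
at most `K` and, up to the first-order term, decrease `φ` quadratically. It expresses that the
negativity of `D²φ(u₀)` on `W` persists near `u₀`. -/
def DescendsAlong (ι : E →L[ℝ] H) (μ : ℝ) (φ : E → ℝ) (W : Submodule ℝ E) (u₀ : E)
    (ρ δ K lam : ℝ) : Prop :=
  ∀ u ∈ massSphere ι μ, ‖u - u₀‖ ≤ ρ → ∀ w ∈ W, ‖w‖ = 1 → ∀ s ∈ Icc 0 δ,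
    ‖sphereMove ι μ u w s - u‖ ≤ K * s ∧
      φ (sphereMove ι μ u w s) ≤ φ u + s * fderiv ℝ φ u (tangentProj ι μ u w) - lam * s ^ 2 / 4

theorem exists_descendsAlong (hμ : 0 < μ) (hφ : ContDiff ℝ 2 φ) (hα₀ : 0 ≤ α) (hα₁ : α ≤ 1)
    (hφ' : IsBoundedHolderOn α (Metric.ball 0 R) (fderiv ℝ φ))
    (hφ'' : IsBoundedHolderOn α (Metric.ball 0 R) (fderiv ℝ (fderiv ℝ φ))) :
    ∃ K, 1 ≤ K ∧ ∀ u₀ ∈ massSphere ι μ, ∀ W ≤ tangentSpace ι u₀, ∀ ρ ≤ 1, ∀ lam,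
      ‖u₀‖ + 2 * ρ < R → K * ρ ^ α ≤ lam / 2 →
      (∀ w ∈ W, w ≠ 0 → constrainedHessian ι φ u₀ w w < -lam * ‖w‖ ^ 2) →
      DescendsAlong ι μ φ W u₀ ρ (ρ / K) K lam := by
  obtain ⟨K, hK₁, hK⟩ := exists_constrainedHessian_sphereMove_le (ι := ι) hμ hα₀ hα₁ hφ' hφ''
  refine ⟨K, hK₁, fun u₀ hu₀ W hW ρ hρ₁ lam hρR hlam hneg u hu hρ w hw hw₁ s hs => ?_⟩
  have hmove : ∀ t ∈ Icc 0 s, ‖sphereMove ι μ u w t - u‖ ≤ K * t ∧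
      constrainedHessian ι φ (sphereMove ι μ u w t) (sphereMoveVelocity ι μ u w t)
        (sphereMoveVelocity ι μ u w t) ≤ constrainedHessian ι φ u₀ w w + K * ρ ^ α := by
    intro t ht
    have htρ : K * t ≤ ρ := (le_div_iff₀' (by linarith)).1 (ht.2.trans hs.2)
    simpa only [abs_of_nonneg ht.1] using
      hK u₀ hu₀ ρ hρ₁ hρR u hu hρ w (hW hw) hw₁ t (by rwa [abs_of_nonneg ht.1])
  have hw₀ : w ≠ 0 := norm_ne_zero_iff.1 (hw₁ ▸ one_ne_zero)
  have hneg' : constrainedHessian ι φ u₀ w w < -lam := by simpa [hw₁] using hneg w hw hw₀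
  have hdesc := apply_sphereMove_le (M := -lam / 2) hμ hφ hu hs.1
    fun t ht => (hmove t ht).2.trans (by linarith)
  exact ⟨(hmove s (right_mem_Icc.2 hs.1)).1, by linarith⟩

end Descent

section UnitField

variable {X F : Type*} [NormedAddCommGroup X] [NormedSpace ℝ X] [FiniteDimensional ℝ X]

theorem exists_contDiff_norm_sub_lt [NormedAddCommGroup F] [NormedSpace ℝ F]
    [FiniteDimensional ℝ F] {D : Set X} (hD : IsClosed D) {A : X → F} (hA : ContinuousOn A D)
    {τ : ℝ} (hτ : 0 < τ) : ∃ B : X → F, ContDiff ℝ 1 B ∧ ∀ x ∈ D, ‖A x - B x‖ < τ := by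
  obtain ⟨A', hA'⟩ := ContinuousMap.exists_restrict_eq hD ⟨D.domRestrict A, hA.domRestrict⟩
  obtain ⟨B, hB, hBA, -⟩ := A'.continuous.exists_contDiff_approx 1
    (continuous_const (y := τ)) fun _ => hτ
  refine ⟨B, hB, fun x hx => ?_⟩
  have hAx : A' x = A x := congrArg (fun G : C(D, F) => G ⟨x, hx⟩) hA'
  rw [← hAx, ← dist_eq_norm, dist_comm]
  exact hBA x

theorem exists_continuous_ne_zero_norm_sub_lt [NormedAddCommGroup F] [NormedSpace ℝ F]
    [FiniteDimensional ℝ F] (hdim : Module.finrank ℝ X < Module.finrank ℝ F) {D : Set X}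
    (hD : IsClosed D) {A : X → F} (hA : ContinuousOn A D) {τ : ℝ} (hτ : 0 < τ) :
    ∃ B : X → F, Continuous B ∧ (∀ x, B x ≠ 0) ∧ ∀ x ∈ D, ‖A x - B x‖ < τ := by
  obtain ⟨B, hB, hBA⟩ := exists_contDiff_norm_sub_lt hD hA (half_pos hτ)
  -- A `C¹` map into a space of larger dimension omits arbitrarily small values `p`.
  obtain ⟨p, hp, hpB⟩ := Metric.dense_iff.1 (hB.dense_compl_range_of_finrank_lt_finrank hdim)
    0 (τ / 2) (half_pos hτ)
  refine ⟨fun x => B x - p, hB.continuous.sub continuous_const,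
    fun x hx => hpB ⟨x, sub_eq_zero.1 hx⟩, fun x hx => ?_⟩
  calc ‖A x - (B x - p)‖ = ‖A x - B x + p‖ := by rw [sub_sub_eq_add_sub, add_sub_right_comm]
    _ ≤ ‖A x - B x‖ + ‖p‖ := norm_add_le _ _
    _ < τ / 2 + τ / 2 := add_lt_add (hBA x hx) (mem_ball_zero_iff.1 hp)
    _ = τ := add_halves τ

theorem exists_unit_field_inner_le [NormedAddCommGroup F] [InnerProductSpace ℝ F]
    [FiniteDimensional ℝ F] (hdim : Module.finrank ℝ X < Module.finrank ℝ F) {D : Set X}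
    (hD : IsClosed D) {A : X → F} (hA : ContinuousOn A D) {τ : ℝ} (hτ : 0 < τ) :
    ∃ w : X → F, Continuous w ∧ (∀ x, ‖w x‖ = 1) ∧ ∀ x ∈ D, inner ℝ (A x) (w x) ≤ τ := by
  obtain ⟨B, hB, hB₀, hBA⟩ := exists_continuous_ne_zero_norm_sub_lt hdim hD hA hτ
  have hunit : ∀ x, ‖-(‖B x‖⁻¹ • B x)‖ = 1 := fun x => by
    rw [norm_neg, norm_smul, norm_inv, norm_norm, inv_mul_cancel₀ (norm_ne_zero_iff.2 (hB₀ x))]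
  refine ⟨fun x => -(‖B x‖⁻¹ • B x),
    ((hB.norm.inv₀ fun x => norm_ne_zero_iff.2 (hB₀ x)).smul hB).neg, hunit, fun x hx => ?_⟩
  have hB_le : inner ℝ (B x) (-(‖B x‖⁻¹ • B x)) ≤ 0 := by
    rw [inner_neg_right, inner_smul_right, real_inner_self_eq_norm_sq, Left.neg_nonpos_iff]
    positivity
  have hsub_le : inner ℝ (A x - B x) (-(‖B x‖⁻¹ • B x)) ≤ τ := by
    refine (real_inner_le_norm _ _).trans ?_
    rw [hunit, mul_one]
    exact (hBA x hx).le
  rw [inner_sub_left] at hsub_le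
  linarith

theorem exists_unit_field_apply_le [NormedAddCommGroup F] [InnerProductSpace ℝ F]
    [FiniteDimensional ℝ F] (hdim : Module.finrank ℝ X < Module.finrank ℝ F) {D : Set X}
    (hD : IsClosed D) {T : X → F →L[ℝ] ℝ} (hT : ContinuousOn T D) {τ : ℝ} (hτ : 0 < τ) :
    ∃ w : X → F, Continuous w ∧ (∀ x, ‖w x‖ = 1) ∧ ∀ x ∈ D, T x (w x) ≤ τ := by
  obtain ⟨w, hw, hw₁, hwτ⟩ := exists_unit_field_inner_le hdim hD
    ((InnerProductSpace.toDual ℝ F).symm.continuous.comp_continuousOn hT) hτ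
  exact ⟨w, hw, hw₁, fun x hx => by simpa using hwτ x hx⟩

end UnitField

section BoundedOverlap

variable {X : Type*} [NormedAddCommGroup X] [NormedSpace ℝ X] [FiniteDimensional ℝ X]

theorem exists_finset_isSeparated_isCover {Y : Type*} [PseudoEMetricSpace Y] {s : Set Y}
    (hs : TotallyBounded s) {e : NNReal} (he : e ≠ 0) :
    ∃ Z : Finset Y, ↑Z ⊆ s ∧ Metric.IsSeparated e (Z : Set Y) ∧ Metric.IsCover e s Z := by
  obtain ⟨N, -, hN, hcover⟩ := Metric.exists_finite_isCover_of_totallyBounded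
    (div_ne_zero he two_ne_zero) hs
  have hpack : Metric.packingNumber e s ≠ ⊤ := by
    have := Metric.packingNumber_two_mul_le_externalCoveringNumber (e / 2) s
    rw [mul_div_cancel₀ _ two_ne_zero] at this
    exact ((this.trans hcover.externalCoveringNumber_le_encard).trans_lt
      hN.encard_lt_top).ne
  have hfin : (Metric.maximalSeparatedSet e s).Finite :=
    encard_ne_top_iff.1 (Metric.encard_maximalSeparatedSet hpack ▸ hpack)
  refine ⟨hfin.toFinset, ?_, ?_, ?_⟩ <;> rw [hfin.coe_toFinset]
  exacts [Metric.maximalSeparatedSet_subset, Metric.isSeparated_maximalSeparatedSet,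
    Metric.isCover_maximalSeparatedSet hpack]

theorem card_le_multiplicity_of_isSeparated {e : NNReal} (he : e ≠ 0) {x : X} {Z : Finset X}
    (hsep : Metric.IsSeparated e (Z : Set X)) (hZ : ∀ z ∈ Z, dist x z ≤ 2 * e) :
    Z.card ≤ Besicovitch.multiplicity X := by
  classical
  have he' : (0 : ℝ) < e := by positivity
  have hnorm (v : X) : ‖(e : ℝ)⁻¹ • v‖ = ‖v‖ / e := by
    rw [norm_smul, norm_inv, NNReal.norm_eq, inv_mul_eq_div]
  have hinj : Function.Injective fun z : X => (e : ℝ)⁻¹ • (z - x) := fun a b hab => by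
    simpa [he] using hab
  rw [← Finset.card_image_of_injective Z hinj]
  refine Besicovitch.card_le_multiplicity ?_ ?_
  · simp only [Finset.forall_mem_image]
    intro z hz
    rw [hnorm, div_le_iff₀ he', ← dist_eq_norm, dist_comm]
    exact hZ z hz
  · simp only [Finset.forall_mem_image]
    intro z hz y hy hzy
    rw [← smul_sub, sub_sub_sub_cancel_right, hnorm, one_le_div he', ← dist_eq_norm]
    have hlt : (e : ENNReal) < edist z y := hsep hz hy fun h => hzy (by rw [h])
    rw [edist_nndist, ENNReal.coe_lt_coe] at hlt
    exact hlt.le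

end BoundedOverlap

theorem exists_cutoff {X : Type*} [PseudoMetricSpace X] {e : ℝ} (z : X) (he : 0 < e) :
    ∃ ψ : X → ℝ, Continuous ψ ∧ (∀ x, ψ x ∈ Icc 0 1) ∧ (∀ x, dist x z ≤ e → ψ x = 1) ∧
      ∀ x, 2 * e ≤ dist x z → ψ x = 0 := by
  obtain ⟨ψ, hψ₀, hψ₁, hψ⟩ := exists_continuous_zero_one_of_isClosed
    (s := {x | 2 * e ≤ dist x z}) (t := Metric.closedBall z e)
    (isClosed_le continuous_const (by fun_prop)) Metric.isClosed_closedBall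
    (disjoint_left.2 fun x (hx : 2 * e ≤ dist x z) hxe => by
      linarith [Metric.mem_closedBall.1 hxe])
  exact ⟨ψ, ψ.continuous, hψ, fun x hx => hψ₁ hx, fun x hx => hψ₀ hx⟩

theorem IsEquivariant.symmetrize {E H X : Type*} [NormedAddCommGroup E] [InnerProductSpace ℝ E]
    [NormedAddCommGroup H] [InnerProductSpace ℝ H] [TopologicalSpace X] {ι : E →L[ℝ] H} {μ : ℝ}
    {σ : X → X} {D : Set X} {g : X → E} (hg : IsEquivariant ι μ σ D g) (hσ : Continuous σ)
    (hσ₂ : Function.Involutive σ) (hσD : MapsTo σ D D) {m : X → E} (hm : ContinuousOn m D)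
    (hmS : MapsTo m D (massSphere ι μ)) (hor : ∀ x ∈ D, m x = g x ∨ m (σ x) = g (σ x)) :
    ∃ g', IsEquivariant ι μ σ D g' ∧ ∀ x ∈ D, m (σ x) = g (σ x) → g' x = m x := by
  have hfix : ∀ x ∈ D, m (σ x) = g (σ x) → m x - m (σ x) - g x = m x := fun x hx h => by
    rw [h, hg.equivariant x hx]
    abel
  refine ⟨fun x => m x - m (σ x) - g x, ⟨?_, fun x hx => ?_, fun x hx => ?_⟩, hfix⟩
  · exact (hm.sub (hm.comp hσ.continuousOn hσD)).sub hg.continuousOn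
  · rcases hor x hx with h | h
    · rw [h, sub_right_comm, sub_self, zero_sub, neg_mem_massSphere]
      exact hmS (hσD hx)
    · rw [hfix x hx h]
      exact hmS hx
  · rw [hσ₂ x, hg.equivariant x hx]
    abel

/-- The distance from `z` to the orbit `{x, σ x}`. -/
noncomputable def orbitDist {X : Type*} [PseudoMetricSpace X] (σ : X → X) (z x : X) : ℝ :=
  min (dist x z) (dist (σ x) z)

section Equivariant

variable {E H X : Type*} [NormedAddCommGroup E] [InnerProductSpace ℝ E]
  [NormedAddCommGroup H] [InnerProductSpace ℝ H] [NormedAddCommGroup X] [NormedSpace ℝ X]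
  [FiniteDimensional ℝ X] {ι : E →L[ℝ] H} {μ : ℝ} {φ : E → ℝ} {W : Submodule ℝ E} {u₀ : E}
  {σ : X → X} {D : Set X} {f g : X → E} {x z : X} {ρ δ K lam τ e : ℝ}

theorem continuous_tangentProj : Continuous (tangentProj ι μ) := by
  unfold tangentProj
  have := (ContinuousLinearMap.smulRightL ℝ E E).continuous₂
  fun_prop

theorem exists_unit_field_fderiv_tangentProj_le (hφ : Continuous (fderiv ℝ φ)) (hD : IsClosed D)
    (hg : ContinuousOn g D) (hW : Module.finrank ℝ X < Module.finrank ℝ W) (hτ : 0 < τ) :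
    ∃ w : X → E, Continuous w ∧ (∀ x, w x ∈ W ∧ ‖w x‖ = 1) ∧
      ∀ x ∈ D, fderiv ℝ φ (g x) (tangentProj ι μ (g x) (w x)) ≤ τ := by
  have : FiniteDimensional ℝ W := Module.finite_of_finrank_pos (by omega)
  obtain ⟨w, hw, hw₁, hwτ⟩ := exists_unit_field_apply_le hW hD
    (T := fun x => ((fderiv ℝ φ (g x)).comp (tangentProj ι μ (g x))).comp W.subtypeL)
    (((hφ.comp_continuousOn hg).clm_comp
      (continuous_tangentProj.comp_continuousOn hg)).clm_comp continuousOn_const) hτ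
  exact ⟨fun x => w x, continuous_subtype_val.comp hw, fun x => ⟨(w x).2, hw₁ x⟩, hwτ⟩

theorem DescendsAlong.exists_local_descent (hdesc : DescendsAlong ι μ φ W u₀ ρ δ K lam)
    (hμ : 0 < μ) (hφ : Continuous (fderiv ℝ φ)) (hD : IsClosed D) (hg : ContinuousOn g D)
    (hgS : MapsTo g D (massSphere ι μ)) (hW : Module.finrank ℝ X < Module.finrank ℝ W)
    (hK : 0 ≤ K) (hδ : 0 ≤ δ) (hlam : 0 ≤ lam) (he : 0 < e)
    (hnear : ∀ x ∈ D, dist x z < 2 * e → ‖g x - u₀‖ ≤ ρ) (hτ : 0 < τ) :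
    ∃ m : X → E, ContinuousOn m D ∧ MapsTo m D (massSphere ι μ) ∧ ∀ x ∈ D,
      (2 * e ≤ dist x z → m x = g x) ∧ ‖m x - g x‖ ≤ K * δ ∧ φ (m x) ≤ φ (g x) + δ * τ ∧
      (dist x z ≤ e → φ (m x) ≤ φ (g x) + δ * τ - δ ^ 2 * lam / 4) := by
  obtain ⟨w, hw, hwW, hwτ⟩ :=
    exists_unit_field_fderiv_tangentProj_le (ι := ι) (μ := μ) hφ hD hg hW hτ
  obtain ⟨ψ, hψ, hψ₀₁, hψ₁, hψ₀⟩ := exists_cutoff z he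
  have hfar : ∀ x, 2 * e ≤ dist x z → sphereMove ι μ (g x) (w x) (δ * ψ x) = g x := fun x hx => by
    rw [hψ₀ x hx, mul_zero, sphereMove_zero]
  refine ⟨fun x => sphereMove ι μ (g x) (w x) (δ * ψ x),
    continuousOn_sphereMove hg hw.continuousOn (continuousOn_const.mul hψ.continuousOn),
    fun x hx => sphereMove_mem hμ (hgS hx) _ _, fun x hx => ⟨hfar x, ?_⟩⟩
  beta_reduce
  rcases le_or_gt (2 * e) (dist x z) with hxz | hxz
  · rw [hfar x hxz, sub_self, norm_zero]
    exact ⟨by positivity, le_add_of_nonneg_right (by positivity), fun hxe => by linarith⟩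
  have hs : δ * ψ x ∈ Icc 0 δ :=
    ⟨mul_nonneg hδ (hψ₀₁ x).1, mul_le_of_le_one_right hδ (hψ₀₁ x).2⟩
  obtain ⟨hmove, hle⟩ := hdesc _ (hgS hx) (hnear x hx hxz) _ (hwW x).1 (hwW x).2 _ hs
  have hfirst : δ * ψ x * fderiv ℝ φ (g x) (tangentProj ι μ (g x) (w x)) ≤ δ * τ :=
    (mul_le_mul_of_nonneg_left (hwτ x hx) hs.1).trans (mul_le_mul_of_nonneg_right hs.2 hτ.le)
  have hsecond : 0 ≤ lam * (δ * ψ x) ^ 2 / 4 := by positivity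
  refine ⟨hmove.trans (mul_le_mul_of_nonneg_left hs.2 hK), by linarith, fun hxe => ?_⟩
  rw [hψ₁ x hxe, mul_one] at hle hfirst ⊢
  linarith

theorem DescendsAlong.exists_isEquivariant_step (hdesc : DescendsAlong ι μ φ W u₀ ρ δ K lam)
    (hμ : 0 < μ) (hφ : Continuous (fderiv ℝ φ)) (heven : ∀ u ∈ massSphere ι μ, φ (-u) = φ u)
    (hσ : Continuous σ) (hσ₂ : Function.Involutive σ) (hD : IsClosed D) (hσD : MapsTo σ D D)
    (hg : IsEquivariant ι μ σ D g) (hW : Module.finrank ℝ X < Module.finrank ℝ W)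
    (hK : 0 ≤ K) (hδ : 0 ≤ δ) (hlam : 0 ≤ lam) (he : 0 < e)
    (hsep : ∀ x ∈ D, 4 * e ≤ dist x (σ x))
    (hnear : ∀ x ∈ D, dist x z < 2 * e → ‖g x - u₀‖ ≤ ρ) (hτ : 0 < τ) :
    ∃ g', IsEquivariant ι μ σ D g' ∧ ∀ x ∈ D,
      (2 * e ≤ orbitDist σ z x → g' x = g x) ∧ ‖g' x - g x‖ ≤ K * δ ∧
      φ (g' x) ≤ φ (g x) + δ * τ ∧
      (orbitDist σ z x ≤ e → φ (g' x) ≤ φ (g x) + δ * τ - δ ^ 2 * lam / 4) := by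
  obtain ⟨m, hm, hmS, hmg⟩ := hdesc.exists_local_descent hμ hφ hD hg.continuousOn hg.mapsTo hW
    hK hδ hlam he hnear hτ
  have hfar : ∀ x ∈ D, dist x z ≤ dist (σ x) z → 2 * e ≤ dist (σ x) z := fun x hx h => by
    linarith [hsep x hx, dist_triangle_right x (σ x) z]
  have hfar' : ∀ x ∈ D, dist (σ x) z ≤ dist x z → 2 * e ≤ dist x z := fun x hx h => by
    simpa only [hσ₂ x] using hfar (σ x) (hσD hx) (by simpa only [hσ₂ x] using h)
  obtain ⟨g', hg', hg'm⟩ := hg.symmetrize hσ hσ₂ hσD hm hmS fun x hx =>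
    (le_total (dist (σ x) z) (dist x z)).imp (fun h => (hmg x hx).1 (hfar' x hx h))
      fun h => (hmg _ (hσD hx)).1 (hfar x hx h)
  refine ⟨g', hg', fun x hx => ?_⟩
  rcases le_total (dist x z) (dist (σ x) z) with h | h
  · rw [orbitDist, min_eq_left h, hg'm x hx ((hmg _ (hσD hx)).1 (hfar x hx h))]
    exact hmg x hx
  · have hmx : m (σ (σ x)) = g (σ (σ x)) := (hσ₂ x).symm ▸ (hmg x hx).1 (hfar' x hx h)
    have hg'x : g' x = -m (σ x) := by
      rw [← hg'm _ (hσD hx) hmx, hg'.equivariant x hx, neg_neg]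
    have hgx : g x = -g (σ x) := by rw [hg.equivariant x hx, neg_neg]
    rw [orbitDist, min_eq_right h, hg'x, hgx, neg_inj, neg_sub_neg, norm_sub_rev,
      heven _ (hmS (hσD hx)), heven _ (hg.mapsTo (hσD hx))]
    exact hmg _ (hσD hx)

end Equivariant

section Descent

variable {E H X : Type*} [NormedAddCommGroup E] [InnerProductSpace ℝ E]
  [NormedAddCommGroup H] [InnerProductSpace ℝ H] [NormedAddCommGroup X] {ι : E →L[ℝ] H} {μ : ℝ}
  {φ : E → ℝ} {σ : X → X} {D : Set X} {f : X → E} {ρ δ K lam : ℝ}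

theorem IsEquivariant.exists_scale (hf : IsEquivariant ι μ σ D f) (hμ : 0 < μ)
    (hσ : Continuous σ) (hD : IsCompact D) (hρ : 0 < ρ) :
    ∃ e : NNReal, 0 < e ∧ (∀ x ∈ D, ∀ y ∈ D, dist x y < 2 * e → ‖f x - f y‖ ≤ ρ) ∧
      ∀ x ∈ D, 4 * e ≤ dist x (σ x) := by
  obtain ⟨r, hr, hrf⟩ := Metric.uniformContinuousOn_iff_le.1
    (hD.uniformContinuousOn_of_continuous hf.continuousOn) ρ hρ
  have hmoved : ∀ x ∈ D, 0 < dist x (σ x) := fun x hx => dist_pos.2 fun h => by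
    have hzero : (2 : ℝ) • f x = 0 := by
      rw [two_smul, add_eq_zero_iff_eq_neg, ← hf.equivariant x hx, ← h]
    exact map_ne_zero_of_mem_massSphere hμ (hf.mapsTo hx)
      (by rw [(smul_eq_zero.1 hzero).resolve_left two_ne_zero, map_zero])
  obtain ⟨s, hs, hsσ⟩ := hD.exists_forall_le'
    (continuous_id.dist hσ).continuousOn hmoved
  obtain ⟨e, he, her, hes⟩ : ∃ e : NNReal, 0 < e ∧ 2 * (e : ℝ) ≤ r ∧ 4 * (e : ℝ) ≤ s :=
    ⟨⟨min (r / 2) (s / 4), by positivity⟩, lt_min (half_pos hr) (by positivity),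
      (le_div_iff₀' two_pos).1 (min_le_left _ _), (le_div_iff₀' four_pos).1 (min_le_right _ _)⟩
  refine ⟨e, he, fun x hx y hy hxy => ?_, fun x hx => hes.trans (hsσ x hx)⟩
  rw [← dist_eq_norm]
  exact hrf x hx y hy (hxy.le.trans her)

variable [NormedSpace ℝ X] [FiniteDimensional ℝ X]

theorem card_filter_orbitDist_lt_le {e : NNReal} (he : e ≠ 0) {Z : Finset X}
    (hZ : Metric.IsSeparated e (Z : Set X)) (x : X) :
    (Z.filter fun z => orbitDist σ z x < 2 * e).card ≤ 2 * Besicovitch.multiplicity X := by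
  classical
  have hball : ∀ y, (Z.filter fun z => dist y z < 2 * e).card ≤ Besicovitch.multiplicity X :=
    fun y => card_le_multiplicity_of_isSeparated he
      (hZ.subset (Finset.coe_subset.2 (Finset.filter_subset _ _)))
      fun z hz => (Finset.mem_filter.1 hz).2.le
  simp only [orbitDist, min_lt_iff, Finset.filter_or]
  linarith [Finset.card_union_le (Z.filter fun z => dist x z < 2 * e)
    (Z.filter fun z => dist (σ x) z < 2 * e), hball x, hball (σ x)]

theorem IsEquivariant.exists_descent_of_finset (hf : IsEquivariant ι μ σ D f) (hμ : 0 < μ)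
    (hφ : Continuous (fderiv ℝ φ)) (heven : ∀ u ∈ massSphere ι μ, φ (-u) = φ u)
    (hσ : Continuous σ) (hσ₂ : Function.Involutive σ) (hD : IsClosed D) (hσD : MapsTo σ D D)
    (hK : 0 ≤ K) (hδ : 0 ≤ δ) (hlam : 0 ≤ lam) {e τ : ℝ} (he : 0 < e) (hτ : 0 < τ)
    (hsep : ∀ x ∈ D, 4 * e ≤ dist x (σ x)) {Z : Finset X}
    (hnear : ∀ z ∈ Z, ∀ x ∈ D, dist x z < 2 * e → ‖f x - f z‖ ≤ ρ / 2)
    (hcount : ∀ x ∈ D, K * δ * (Z.filter fun z => orbitDist σ z x < 2 * e).card ≤ ρ / 2)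
    (hdesc : ∀ z ∈ Z, ∃ W : Submodule ℝ E, Module.finrank ℝ X < Module.finrank ℝ W ∧
      DescendsAlong ι μ φ W (f z) ρ δ K lam) :
    ∃ g, IsEquivariant ι μ σ D g ∧ ∀ x ∈ D,
      ‖g x - f x‖ ≤ K * δ * (Z.filter fun z => orbitDist σ z x < 2 * e).card ∧
      φ (g x) ≤ φ (f x) + Z.card * (δ * τ) ∧
      ∀ z ∈ Z, orbitDist σ z x ≤ e →
        φ (g x) ≤ φ (f x) + Z.card * (δ * τ) - δ ^ 2 * lam / 4 := by
  classical
  refine Finset.induction_on' (motive := fun Y => ∃ g, IsEquivariant ι μ σ D g ∧ ∀ x ∈ D,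
    ‖g x - f x‖ ≤ K * δ * (Y.filter fun z => orbitDist σ z x < 2 * e).card ∧
    φ (g x) ≤ φ (f x) + Y.card * (δ * τ) ∧ ∀ z ∈ Y, orbitDist σ z x ≤ e →
      φ (g x) ≤ φ (f x) + Y.card * (δ * τ) - δ ^ 2 * lam / 4) Z
    ⟨f, hf, fun x _ => by simp⟩ ?_
  rintro a Y ha hYZ haY ⟨g, hg, hgf⟩
  obtain ⟨W, hW, hWdesc⟩ := hdesc a ha
  have hga : ∀ x ∈ D, dist x a < 2 * e → ‖g x - f a‖ ≤ ρ := fun x hx hxa => by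
    have hsub : K * δ * (Y.filter fun z => orbitDist σ z x < 2 * e).card ≤
        K * δ * (Z.filter fun z => orbitDist σ z x < 2 * e).card := by
      gcongr
    linarith [norm_sub_le_norm_sub_add_norm_sub (g x) (f x) (f a), hnear a ha x hx hxa,
      hcount x hx, (hgf x hx).1]
  obtain ⟨g', hg', hg'g⟩ := hWdesc.exists_isEquivariant_step hμ hφ heven hσ hσ₂ hD hσD hg hW
    hK hδ hlam he hsep hga hτ
  refine ⟨g', hg', fun x hx => ?_⟩
  obtain ⟨hdist, hle, hlt⟩ := hgf x hx
  obtain ⟨hfix, hdist', hle', hlt'⟩ := hg'g x hx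
  rw [Finset.card_insert_of_notMem haY, Nat.cast_succ, Finset.filter_insert]
  refine ⟨?_, by linarith, fun z hz hxz => ?_⟩
  · split_ifs with hxa
    · rw [Finset.card_insert_of_notMem fun h => haY (Finset.filter_subset _ _ h), Nat.cast_succ]
      linarith [norm_sub_le_norm_sub_add_norm_sub (g' x) (g x) (f x)]
    · rwa [hfix (not_lt.1 hxa)]
  · rcases Finset.mem_insert.1 hz with rfl | hzY
    · linarith [hlt' hxz]
    · linarith [hlt z hzY hxz]

theorem IsEquivariant.exists_descent (hf : IsEquivariant ι μ σ D f) (hμ : 0 < μ)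
    (hφ : Continuous (fderiv ℝ φ)) (heven : ∀ u ∈ massSphere ι μ, φ (-u) = φ u)
    (hσ : Continuous σ) (hσ₂ : Function.Involutive σ) (hD : IsCompact D) (hσD : MapsTo σ D D)
    (hK : 0 ≤ K) (hδ : 0 < δ) (hlam : 0 ≤ lam) (hρ : 0 < ρ)
    (hδρ : K * δ * (2 * Besicovitch.multiplicity X) ≤ ρ / 2) {B : Set X} (hB : B ⊆ D)
    (hdesc : ∀ z ∈ B, ∃ W : Submodule ℝ E, Module.finrank ℝ X < Module.finrank ℝ W ∧
      DescendsAlong ι μ φ W (f z) ρ δ K lam) {ε : ℝ} (hε : 0 < ε) :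
    ∃ g, IsEquivariant ι μ σ D g ∧ ∀ x ∈ D, ‖g x - f x‖ ≤ ρ / 2 ∧ φ (g x) ≤ φ (f x) + ε ∧
      (g x ≠ f x → ∃ z ∈ B, ‖f x - f z‖ ≤ ρ / 2 ∨ ‖f x + f z‖ ≤ ρ / 2) ∧
      (x ∈ B ∨ σ x ∈ B → φ (g x) ≤ φ (f x) + ε - δ ^ 2 * lam / 4) := by
  obtain ⟨e, he, hfe, hsep⟩ := hf.exists_scale hμ hσ hD (half_pos hρ)
  obtain ⟨Z, hZB, hZsep, hZcover⟩ :=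
    exists_finset_isSeparated_isCover (hD.totallyBounded.subset hB) he.ne'
  have hcount : ∀ x ∈ D, K * δ * (Z.filter fun z => orbitDist σ z x < 2 * e).card ≤ ρ / 2 :=
    fun x _ => le_trans (mul_le_mul_of_nonneg_left
      (mod_cast card_filter_orbitDist_lt_le he.ne' hZsep x) (by positivity)) hδρ
  have hnear : ∀ z ∈ Z, ∀ x ∈ D, dist x z < 2 * e → ‖f x - f z‖ ≤ ρ / 2 :=
    fun z hz x hx => hfe x hx z (hB (hZB hz))
  obtain ⟨g, hg, hgf⟩ := hf.exists_descent_of_finset hμ hφ heven hσ hσ₂ hD.isClosed hσD hK hδ.le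
    hlam (NNReal.coe_pos.2 he) (show 0 < ε / (δ * (Z.card + 1)) by positivity) hsep hnear hcount
    fun z hz => hdesc z (hZB hz)
  have hτ : Z.card * (δ * (ε / (δ * (Z.card + 1)))) ≤ ε := by
    rw [← mul_div_assoc δ, mul_div_mul_left _ _ hδ.ne', ← mul_div_assoc,
      div_le_iff₀ (by positivity)]
    linarith
  refine ⟨g, hg, fun x hx => ?_⟩
  obtain ⟨hdist, hle, hlt⟩ := hgf x hx
  refine ⟨hdist.trans (hcount x hx), by linarith, fun hne => ?_, fun hxB => ?_⟩
  · by_contra! hfar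
    have hempty : (Z.filter fun z => orbitDist σ z x < 2 * e) = ∅ :=
      Finset.filter_eq_empty_iff.2 fun z hz hxz => by
        rcases min_lt_iff.1 hxz with h | h
        · exact (hfar z (hZB hz)).1.not_ge (hnear z hz x hx h)
        · have := hnear z hz _ (hσD hx) h
          rw [hf.equivariant x hx, ← neg_add', norm_neg] at this
          exact (hfar z (hZB hz)).2.not_ge this
    rw [hempty, Finset.card_empty, Nat.cast_zero, mul_zero] at hdist
    exact hne (sub_eq_zero.1 (norm_le_zero_iff.1 hdist))
  · obtain ⟨z, hz, hxz⟩ : ∃ z ∈ Z, orbitDist σ z x ≤ e := by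
      rcases hxB with h | h <;> obtain ⟨z, hz, hxz⟩ := hZcover h
      · exact ⟨z, hz, min_le_of_left_le (edist_le_coe.1 hxz)⟩
      · exact ⟨z, hz, min_le_of_right_le (edist_le_coe.1 hxz)⟩
    linarith [hlt z hz hxz]

end Descent

open Filter in
theorem tendsto_const_mul_rpow_nhdsGT_zero (C : ℝ) {p : ℝ} (hp : 0 < p) :
    Tendsto (fun ε : ℝ => C * ε ^ p) (𝓝[>] 0) (𝓝 0) := by
  have h := ((Real.continuousAt_rpow_const 0 p (.inr hp.le)).const_mul C).tendsto
  rw [Real.zero_rpow hp.ne', mul_zero] at h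
  exact h.mono_left nhdsWithin_le_nhds

theorem eventually_exists_scale {α α₁ A r : ℝ} (M : ℝ) (hα : 0 < α) (hα₁₀ : 0 < α₁)
    (hα₁ : α₁ ≤ α / (2 * (α + 2))) (hA : 0 < A) (hr : 0 < r) :
    ∀ᶠ ε in 𝓝[>] (0 : ℝ), ∃ ρ, 0 < ρ ∧ ρ < r ∧ A * ρ ^ α = ε ^ α₁ ∧ M * ε ≤ ρ ^ 2 * ε ^ α₁ := by
  set κ : ℝ := (1 / A) ^ (1 / α) with hκ
  have hκ₀ : 0 < κ := by positivity
  have hexponent : α₁ / α * 2 + α₁ < 1 := by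
    have := (le_div_iff₀ (by positivity)).1 hα₁
    rw [div_mul_eq_mul_div, div_add' _ _ _ hα.ne', div_lt_one hα]
    linarith
  filter_upwards [
    (tendsto_const_mul_rpow_nhdsGT_zero κ (div_pos hα₁₀ hα)).eventually_lt_const hr,
    (tendsto_const_mul_rpow_nhdsGT_zero M (sub_pos.2 hexponent)).eventually_lt_const
      (show 0 < κ ^ 2 by positivity),
    self_mem_nhdsWithin] with ε hε_r hε_M (hε : 0 < ε)
  refine ⟨κ * ε ^ (α₁ / α), by positivity, hε_r, ?_, ?_⟩
  · rw [Real.mul_rpow hκ₀.le (by positivity), hκ, ← Real.rpow_mul (by positivity),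
      ← Real.rpow_mul hε.le, one_div_mul_cancel hα.ne', div_mul_cancel₀ _ hα.ne', Real.rpow_one]
    field_simp
  · calc M * ε = M * ε ^ (1 - (α₁ / α * 2 + α₁)) * ε ^ (α₁ / α * 2 + α₁) := by
          rw [mul_assoc, ← Real.rpow_add hε, sub_add_cancel, Real.rpow_one]
      _ ≤ κ ^ 2 * ε ^ (α₁ / α * 2 + α₁) := by gcongr
      _ = (κ * ε ^ (α₁ / α)) ^ 2 * ε ^ α₁ := by
          rw [Real.rpow_add hε, Real.rpow_mul hε.le, Real.rpow_two]
          ring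

section Scales

variable {E H : Type*} [NormedAddCommGroup E] [InnerProductSpace ℝ E]
  [NormedAddCommGroup H] [InnerProductSpace ℝ H] {ι : E →L[ℝ] H} {μ : ℝ} {φ : E → ℝ}
  {W : Submodule ℝ E} {u : E} {R ρ δ K lam : ℝ} {n : ℕ}

/-- `T_u S_μ` contains an `n`-dimensional subspace on which `D²φ(u)` lies below `-lam ‖·‖²`. -/
def HasNegativeSubspace (ι : E →L[ℝ] H) (φ : E → ℝ) (u : E) (lam : ℝ) (n : ℕ) : Prop :=
  ∃ W ≤ tangentSpace ι u, Module.finrank ℝ W = n ∧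
    ∀ w ∈ W, w ≠ 0 → constrainedHessian ι φ u w w < -lam * ‖w‖ ^ 2

theorem exists_submodule_finrank_eq_succ (h : ¬Module.rank ℝ W ≤ n) :
    ∃ W' ≤ W, Module.finrank ℝ W' = n + 1 := by
  have hle : ((n + 1 : ℕ) : Cardinal) ≤ Module.rank ℝ W := by
    rw [Nat.cast_succ, ← Cardinal.succ_natCast]
    exact Order.succ_le_of_lt (not_le.1 h)
  obtain ⟨l, hl⟩ := Module.le_rank_iff_exists_linearMap.1 hle
  refine ⟨(W.subtype ∘ₗ l).range, ?_, ?_⟩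
  · rintro _ ⟨x, rfl⟩
    exact (l x).2
  · have hinj : Function.Injective (W.subtype ∘ₗ l) := W.subtype_injective.comp hl
    rw [LinearMap.finrank_range_of_inj hinj, Module.finrank_fin_fun]

theorem rank_le_of_not_hasNegativeSubspace (h : ¬HasNegativeSubspace ι φ u lam (n + 1))
    (hW : W ≤ tangentSpace ι u)
    (hneg : ∀ w ∈ W, w ≠ 0 → constrainedHessian ι φ u w w < -lam * ‖w‖ ^ 2) :
    Module.rank ℝ W ≤ n := by
  by_contra hrank
  obtain ⟨W', hW', hdim⟩ := exists_submodule_finrank_eq_succ hrank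
  exact h ⟨W', hW'.trans hW, hdim, fun w hw => hneg w (hW' hw)⟩

theorem HolderDerivsOnBounded.isBoundedHolderOn {α : ℝ} (h : HolderDerivsOnBounded φ α)
    (hα : 0 ≤ α) (R : ℝ) :
    IsBoundedHolderOn α (Metric.ball 0 R) (fderiv ℝ φ) ∧
      IsBoundedHolderOn α (Metric.ball 0 R) (fderiv ℝ (fderiv ℝ φ)) := by
  have hR : 0 < max R 1 := lt_max_of_lt_right one_pos
  have hsub : Metric.ball (0 : E) R ⊆ Metric.ball 0 (max R 1) :=
    Metric.ball_subset_ball (le_max_left R 1)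
  obtain ⟨M, -, hM⟩ := h (max R 1) hR
  exact ⟨(IsBoundedHolderOn.of_holder_ball hα hR fun u hu v hv => (hM u hu v hv).1).mono hsub,
    (IsBoundedHolderOn.of_holder_ball hα hR fun u hu v hv => (hM u hu v hv).2).mono hsub⟩

theorem DescendsAlong.mono {u₀ : E} {δ' : ℝ} (h : DescendsAlong ι μ φ W u₀ ρ δ' K lam)
    (hδ : δ ≤ δ') : DescendsAlong ι μ φ W u₀ ρ δ K lam :=
  fun u hu hρ w hw hw₁ s hs => h u hu hρ w hw hw₁ s ⟨hs.1, hs.2.trans hδ⟩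

/-- The radius `ρ`, the step `δ` and the speed `K` allow up to `N` successive moves at each point
of a map into `S_μ`: the moves cover a distance of at most `ρ / 2`, each one decreases `φ` by
several multiples of `ε`, it is available near every point at which the Hessian has an
`n`-dimensional negative subspace, and `‖φ'|_{S_μ}‖` varies by at most `lam` at distance `ρ`. -/
structure IsDescentScale (ι : E →L[ℝ] H) (μ : ℝ) (φ : E → ℝ) (R : ℝ) (n N : ℕ)
    (ε lam ρ δ K : ℝ) : Prop where
  rho_pos : 0 < ρ
  rho_le : ρ ≤ 1 / 2
  delta_pos : 0 < δ
  speed_nonneg : 0 ≤ K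
  moves_le : K * δ * N ≤ ρ / 2
  le_gain : 4 * ε ≤ δ ^ 2 * lam / 4
  norm_constrainedDeriv_le : ∀ u ∈ massSphere ι μ ∩ Metric.ball 0 R,
    ∀ v ∈ massSphere ι μ ∩ Metric.ball 0 R, ‖u - v‖ ≤ ρ →
      ‖constrainedDeriv ι φ u‖ ≤ ‖constrainedDeriv ι φ v‖ + lam
  exists_descendsAlong : ∀ u ∈ massSphere ι μ ∩ Metric.ball 0 (R - 1),
    HasNegativeSubspace ι φ u lam n →
      ∃ W : Submodule ℝ E, Module.finrank ℝ W = n ∧ DescendsAlong ι μ φ W u ρ δ K lam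

theorem eventually_exists_isDescentScale (hμ : 0 < μ) (hφ : ContDiff ℝ 2 φ) {α α₁ : ℝ}
    (hα₀ : 0 < α) (hα₁ : α ≤ 1) (hHolder : HolderDerivsOnBounded φ α) (hα₁₀ : 0 < α₁)
    (hα₁α : α₁ ≤ α / (2 * (α + 2))) (R : ℝ) (n N : ℕ) {r : ℝ} (hr : 0 < r) (M : ℝ) :
    ∀ᶠ ε in 𝓝[>] (0 : ℝ), ∃ ρ δ K, IsDescentScale ι μ φ R n N ε (ε ^ α₁) ρ δ K ∧
      ρ < r ∧ M * ε ≤ ρ * ε ^ α₁ := by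
  obtain ⟨hφ', hφ''⟩ := hHolder.isBoundedHolderOn hα₀.le R
  obtain ⟨K, hK₁, hK⟩ := exists_descendsAlong (ι := ι) hμ hφ hα₀.le hα₁ hφ' hφ''
  obtain ⟨L, hL⟩ := exists_norm_constrainedDeriv_le_add (ι := ι) hα₀.le hα₁ hμ.ne' hφ'
  set B : ℝ := K * (N + 1) with hB
  have hKB : K ≤ B := le_mul_of_one_le_right (by linarith) (by simp)
  filter_upwards [eventually_exists_scale (A := 2 * max K L) (r := min (1 / 2) r)
    (max M (64 * B ^ 2)) hα₀ hα₁₀ hα₁α (by positivity) (by positivity), self_mem_nhdsWithin] with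
    ε ⟨ρ, hρ, hρr, hρα, hερ⟩ (hε : 0 < ε)
  obtain ⟨hρ₂, hρr⟩ := lt_min_iff.1 hρr
  have : 0 < B := by positivity
  have hKL : max K L * ρ ^ α = ε ^ α₁ / 2 := by linarith
  have : 0 < max K L := lt_max_of_lt_left (by linarith)
  have hKρ : K * ρ ^ α ≤ ε ^ α₁ / 2 := by
    rw [← hKL]
    gcongr
    exact le_max_left K L
  have hε₁ : 0 < ε ^ α₁ := by positivity
  refine ⟨ρ, ρ / (2 * B), K, ⟨hρ, hρ₂.le, by positivity, by linarith, ?_, ?_, ?_, ?_⟩, hρr, ?_⟩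
  · rw [mul_div_assoc', div_mul_eq_mul_div, div_le_div_iff₀ (by positivity) two_pos, hB]
    nlinarith [mul_pos (show 0 < K by linarith) hρ]
  · have := (mul_le_mul_of_nonneg_right (le_max_right M (64 * B ^ 2)) hε.le).trans hερ
    rw [div_pow, div_mul_eq_mul_div, div_div, le_div_iff₀ (by positivity)]
    linarith
  · intro u hu v hv huv
    have hLρ : L * ‖u - v‖ ^ α ≤ max K L * ρ ^ α := by
      gcongr
      exact le_max_right K L
    linarith [hL u hu.2 v hv]
  · rintro u ⟨hu, huR⟩ ⟨W, hWu, hW, hneg⟩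
    refine ⟨W, hW, (hK u hu W hWu ρ (by linarith) _ ?_ hKρ hneg).mono ?_⟩
    · linarith [mem_ball_zero_iff.1 huR]
    · gcongr
      linarith
  · refine ((mul_le_mul_of_nonneg_right (le_max_left M (64 * B ^ 2)) hε.le).trans hερ).trans ?_
    gcongr
    nlinarith

end Scales

theorem neg_mem_closure_iff {E : Type*} [NormedAddCommGroup E] {Q : Set E}
    (hQ : ∀ u, -u ∈ Q ↔ u ∈ Q) {u : E} : -u ∈ closure Q ↔ u ∈ closure Q := by
  have h := (Homeomorph.neg E).preimage_closure Q
  rw [show Homeomorph.neg E ⁻¹' Q = Q from Set.ext hQ] at h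
  exact Set.ext_iff.1 h u

section Minimax

variable {E H X : Type*} [NormedAddCommGroup E] [InnerProductSpace ℝ E]
  [NormedAddCommGroup H] [InnerProductSpace ℝ H] {ι : E →L[ℝ] H} {μ : ℝ} {φ : E → ℝ}
  {V : E → E} {P Q S : Set E} {u v : E} {R c ε ξ lam ρ δ K r m C₀ : ℝ} {n N : ℕ}

/-- The points of `S_μ \ closure Q` at level at least `c - ε` at which the norm of the constrained
differential of `φ` is at most `3 lam`. -/
def almostCritical (ι : E →L[ℝ] H) (μ : ℝ) (φ : E → ℝ) (Q : Set E) (c ε lam : ℝ) : Set E :=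
  {u | u ∈ massSphere ι μ ∧ u ∉ closure Q ∧ c - ε ≤ φ u ∧ ‖constrainedDeriv ι φ u‖ ≤ 3 * lam}

theorem neg_mem_almostCritical (hμ : 0 < μ) (hφ : Differentiable ℝ φ)
    (heven : ∀ u ∈ massSphere ι μ, φ (-u) = φ u) (hQ : ∀ u, -u ∈ Q ↔ u ∈ Q)
    (hu : u ∈ almostCritical ι μ φ Q c ε lam) : -u ∈ almostCritical ι μ φ Q c ε lam := by
  obtain ⟨hu, huQ, hlevel, hcrit⟩ := hu
  refine ⟨neg_mem_massSphere.2 hu, (neg_mem_closure_iff hQ).not.2 huQ, ?_, ?_⟩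
  · rwa [heven u hu]
  · rwa [norm_constrainedDeriv_neg hμ hφ heven hu]

theorem notMem_closure_of_norm_sub_le
    (hsep : ∀ u ∈ P ∩ Metric.ball 0 R, ∀ v ∈ (massSphere ι μ ∩ Metric.ball 0 R) \ Q, r ≤ ‖u - v‖)
    (hV : ∀ u ∈ massSphere ι μ ∩ Metric.ball 0 R, ‖V u‖ ≤ ‖constrainedDeriv ι φ u‖)
    (hm : ∀ u ∈ (Metric.ball 0 R ∩ closure Q) \ P, m ≤ ‖V u‖)
    (hscale : IsDescentScale ι μ φ R n N ε lam ρ δ K) (hρr : ρ < r) (hlam : 4 * lam < m)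
    (hu : u ∈ almostCritical ι μ φ Q c ε lam) (huR : u ∈ Metric.ball 0 (R - 1))
    (hv : v ∈ massSphere ι μ) (hvu : ‖v - u‖ ≤ ρ) : v ∉ closure Q := by
  intro hvQ
  obtain ⟨hu, huQ, -, hcrit⟩ := hu
  rw [mem_ball_zero_iff] at huR
  have huR' : u ∈ Metric.ball 0 R := mem_ball_zero_iff.2 (by linarith)
  have hvR : v ∈ Metric.ball 0 R :=
    mem_ball_zero_iff.2 (by linarith [norm_le_norm_add_norm_sub' v u, hscale.rho_le])
  by_cases hvP : v ∈ P
  · linarith [hsep v ⟨hvP, hvR⟩ u ⟨⟨hu, huR'⟩, fun h => huQ (subset_closure h)⟩]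
  · linarith [hm v ⟨⟨hvR, hvQ⟩, hvP⟩, hV v ⟨hv, hvR⟩,
      hscale.norm_constrainedDeriv_le v ⟨hv, hvR⟩ u ⟨hu, huR'⟩ hvu]

theorem exists_norm_sub_le_of_mem_nbhd {T : Set E} (hξ : 0 < ξ) (hξρ : 6 * ξ ≤ ρ)
    (hST : ∀ u ∈ S, ∃ w ∈ T, ‖u - w‖ ≤ ρ / 2) (hv : v ∈ nbhd ι μ S (2 * ξ)) :
    ∃ w ∈ T, ‖v - w‖ ≤ ρ := by
  obtain ⟨u, hu, hvu⟩ := Metric.mem_thickening_iff.1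
    (Metric.cthickening_subset_thickening' (δ₂ := 3 * ξ) (by linarith) (by linarith) S hv.2)
  obtain ⟨w, hw, huw⟩ := hST u hu
  rw [dist_eq_norm] at hvu
  exact ⟨w, hw, by linarith [norm_sub_le_norm_sub_add_norm_sub v u w]⟩

theorem isDeformable_of_near_noncritical
    (hsep : ∀ u ∈ P ∩ Metric.ball 0 R, ∀ v ∈ (massSphere ι μ ∩ Metric.ball 0 R) \ Q, r ≤ ‖u - v‖)
    (hC₀ : 0 < C₀)
    (hV : ∀ u ∈ massSphere ι μ ∩ Metric.ball 0 R, C₀ * ‖constrainedDeriv ι φ u‖ ≤ ‖V u‖)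
    (hscale : IsDescentScale ι μ φ R n N ε lam ρ δ K) (hρr : ρ < r) {ε' : ℝ} (hε' : 0 < ε')
    (hξ : 0 < ξ) (hξρ : 6 * ξ ≤ ρ) (hεξ : 2 * ε' / ξ ≤ C₀ * (2 * lam))
    (hS : S ⊆ massSphere ι μ \ closure Q) (hSneg : ∀ u ∈ S, -u ∈ S)
    (hnear : ∀ u ∈ S, ∃ w ∈ {w | w ∈ massSphere ι μ \ closure Q ∧ w ∈ Metric.ball 0 (R - 1) ∧
      3 * lam < ‖constrainedDeriv ι φ w‖}, ‖u - w‖ ≤ ρ / 2) :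
    IsDeformable ι μ φ V P Q R S c ε' ξ := by
  have hfar : ∀ v ∈ nbhd ι μ S (2 * ξ), v ∈ Metric.ball 0 R ∧ v ∉ P ∧
      2 * lam ≤ ‖constrainedDeriv ι φ v‖ := fun v hv => by
    obtain ⟨w, ⟨⟨hw, hwQ⟩, hwR, hwcrit⟩, hvw⟩ := exists_norm_sub_le_of_mem_nbhd hξ hξρ hnear hv
    rw [mem_ball_zero_iff] at hwR
    have hwR' : w ∈ Metric.ball 0 R := mem_ball_zero_iff.2 (by linarith)
    have hvR : v ∈ Metric.ball 0 R :=
      mem_ball_zero_iff.2 (by linarith [norm_le_norm_add_norm_sub' v w, hscale.rho_le])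
    refine ⟨hvR, fun hvP => ?_, ?_⟩
    · linarith [hsep v ⟨hvP, hvR⟩ w ⟨⟨hw, hwR'⟩, fun h => hwQ (subset_closure h)⟩]
    · rw [norm_sub_rev] at hvw
      linarith [hscale.norm_constrainedDeriv_le w ⟨hw, hwR'⟩ v ⟨hv.1, hvR⟩ hvw]
  refine ⟨hε', hξ, hS, fun u => ⟨fun hu => neg_neg u ▸ hSneg _ hu, hSneg u⟩,
    fun v hv => ⟨(hfar v hv).1, (hfar v hv).2.1⟩, fun v hv _ => ?_⟩
  obtain ⟨hvR, -, hvcrit⟩ := hfar v hv.2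
  calc 2 * ε' / ξ ≤ C₀ * (2 * lam) := hεξ
    _ ≤ C₀ * ‖constrainedDeriv ι φ v‖ := by gcongr
    _ ≤ ‖V v‖ := hV v ⟨hv.2.1, hvR⟩

theorem IsDeformation.le_of_notMem_closure {η : ℝ → E → E}
    (hη : IsDeformation ι μ φ Q S c ε ξ η) (hξ : 0 ≤ ξ) {b : ℝ} (hb : b ≤ ε)
    (hu : u ∈ massSphere ι μ) (hle : u ∉ closure Q → φ u ≤ c + ε)
    (hS : u ∉ closure Q → c - b ≤ φ u → u ∈ S) (hηu : η ξ u ∉ closure Q) :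
    φ (η ξ u) ≤ c - b := by
  have hξ' : ξ ∈ Icc 0 ξ := ⟨hξ, le_rfl⟩
  have huQ : u ∉ closure Q := fun h => hηu (hη.invariant ξ hξ' u h)
  rcases le_total (c - b) (φ u) with hhigh | hlow
  · linarith [(hη.descend u (hS huQ hhigh) (hle huQ)).resolve_left hηu]
  · calc φ (η ξ u) ≤ φ (η 0 u) := hη.antitone u hu ⟨le_rfl, hξ⟩ hξ' hξ
      _ ≤ c - b := by rwa [hη.zero u hu]

theorem IsDeformation.iSup_le {X : Type*} {D : Set X} {g : X → E} {η : ℝ → E → E}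
    (hη : IsDeformation ι μ φ Q S c ε ξ η) (hξ : 0 ≤ ξ) {b : ℝ} (hb : b ≤ ε)
    (hg : MapsTo g D (massSphere ι μ))
    (hgS : ∀ x ∈ D, g x ∉ closure Q → φ (g x) ≤ c + ε ∧ (c - b ≤ φ (g x) → g x ∈ S)) :
    ⨆ u ∈ (η ξ '' (g '' D)) \ closure Q, (φ u : EReal) ≤ (c - b : ℝ) := by
  refine iSup₂_le fun u hu => ?_
  obtain ⟨⟨_, ⟨x, hx, rfl⟩, rfl⟩, huQ⟩ := hu
  exact EReal.coe_le_coe_iff.2 (hη.le_of_notMem_closure hξ hb (hg hx)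
    (fun h => (hgS x hx h).1) (fun h => (hgS x hx h).2) huQ)

variable [NormedAddCommGroup X] [NormedSpace ℝ X] [FiniteDimensional ℝ X] {σ : X → X} {D : Set X}
  {f : X → E}

theorem IsEquivariant.exists_deformation_below (hf : IsEquivariant ι μ σ D f) (hμ : 0 < μ)
    (hφ : ContDiff ℝ 1 φ) (heven : ∀ u ∈ massSphere ι μ, φ (-u) = φ u)
    (hσ : Continuous σ) (hσ₂ : Function.Involutive σ) (hD : IsCompact D) (hσD : MapsTo σ D D)
    (hQ : ∀ u, -u ∈ Q ↔ u ∈ Q) (hε : 0 < ε) (hlam : 0 ≤ lam)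
    (hscale : IsDescentScale ι μ φ R (Module.finrank ℝ X + 1) (2 * Besicovitch.multiplicity X)
      ε lam ρ δ K)
    (hfc : ∀ x ∈ D, f x ∉ closure Q → φ (f x) ≤ c + ε)
    (hfR : ∀ x ∈ D, f x ∈ almostCritical ι μ φ Q c ε lam → f x ∈ Metric.ball 0 (R - 1))
    (hfar : ∀ x ∈ D, f x ∈ almostCritical ι μ φ Q c ε lam →
      ∀ v ∈ massSphere ι μ, ‖v - f x‖ ≤ ρ → v ∉ closure Q)
    (hneg : ∀ x ∈ D, f x ∈ almostCritical ι μ φ Q c ε lam →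
      HasNegativeSubspace ι φ (f x) lam (Module.finrank ℝ X + 1) ∨
        HasNegativeSubspace ι φ (-f x) lam (Module.finrank ℝ X + 1)) :
    ∃ g, IsEquivariant ι μ σ D g ∧ ∀ x ∈ D, ‖g x - f x‖ ≤ ρ / 2 ∧
      (g x ∉ closure Q → f x ∉ closure Q ∧ φ (g x) ≤ c + 2 * ε ∧
        (c - ε / 2 ≤ φ (g x) → c - ε ≤ φ (f x) ∧ 3 * lam < ‖constrainedDeriv ι φ (f x)‖)) := by
  set B : Set X := {x | x ∈ D ∧ f x ∈ almostCritical ι μ φ Q c ε lam ∧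
    HasNegativeSubspace ι φ (f x) lam (Module.finrank ℝ X + 1)}
  have hBdesc : ∀ z ∈ B, ∃ W : Submodule ℝ E, Module.finrank ℝ X < Module.finrank ℝ W ∧
      DescendsAlong ι μ φ W (f z) ρ δ K lam := by
    rintro z ⟨hzD, hz, hzneg⟩
    obtain ⟨W, hW, hdesc⟩ := hscale.exists_descendsAlong _ ⟨hf.mapsTo hzD, hfR z hzD hz⟩ hzneg
    exact ⟨W, by omega, hdesc⟩
  obtain ⟨g, hg, hgf⟩ := hf.exists_descent hμ (hφ.continuous_fderiv one_ne_zero) heven hσ hσ₂ hD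
    hσD hscale.speed_nonneg hscale.delta_pos hlam hscale.rho_pos
    (by exact_mod_cast hscale.moves_le) (fun z hz => hz.1) hBdesc (half_pos hε)
  refine ⟨g, hg, fun x hx => ?_⟩
  obtain ⟨hdist, hle, hmoved, hlow⟩ := hgf x hx
  have hρ := hscale.rho_pos
  refine ⟨hdist, fun hgQ => ?_⟩
  have hfQ : f x ∉ closure Q := by
    by_cases hgx : g x = f x
    · rwa [← hgx]
    obtain ⟨z, ⟨hzD, hz, -⟩, h | h⟩ := hmoved hgx
    · exact hfar z hzD hz _ (hf.mapsTo hx) (by linarith)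
    · rw [← norm_neg, neg_add'] at h
      exact (neg_mem_closure_iff hQ).not.1
        (hfar z hzD hz _ (neg_mem_massSphere.2 (hf.mapsTo hx)) (by linarith))
  have hfx := hfc x hx hfQ
  refine ⟨hfQ, by linarith, fun hlevel => ⟨by linarith, ?_⟩⟩
  by_contra! hcrit
  have hxcrit : f x ∈ almostCritical ι μ φ Q c ε lam :=
    ⟨hf.mapsTo hx, hfQ, by linarith, hcrit⟩
  have hxB : x ∈ B ∨ σ x ∈ B := (hneg x hx hxcrit).imp (fun h => ⟨hx, hxcrit, h⟩) fun h => by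
    refine ⟨hσD hx, ?_⟩
    rw [hf.equivariant x hx]
    exact ⟨neg_mem_almostCritical hμ (hφ.differentiable one_ne_zero) heven hQ hxcrit, h⟩
  linarith [hlow hxB, hscale.le_gain]

theorem IsEquivariant.exists_isDeformable (hf : IsEquivariant ι μ σ D f) (hμ : 0 < μ)
    (hφ : ContDiff ℝ 1 φ) (heven : ∀ u ∈ massSphere ι μ, φ (-u) = φ u)
    (hσ : Continuous σ) (hσ₂ : Function.Involutive σ) (hD : IsCompact D) (hσD : MapsTo σ D D)
    (hQ : ∀ u, -u ∈ Q ↔ u ∈ Q)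
    (hsep : ∀ u ∈ P ∩ Metric.ball 0 R, ∀ v ∈ (massSphere ι μ ∩ Metric.ball 0 R) \ Q, r ≤ ‖u - v‖)
    (hC₀ : 0 < C₀)
    (hV : ∀ u ∈ massSphere ι μ ∩ Metric.ball 0 R,
      C₀ * ‖constrainedDeriv ι φ u‖ ≤ ‖V u‖ ∧ ‖V u‖ ≤ ‖constrainedDeriv ι φ u‖)
    (hm : ∀ u ∈ (Metric.ball 0 R ∩ closure Q) \ P, m ≤ ‖V u‖)
    (hscale : IsDescentScale ι μ φ R (Module.finrank ℝ X + 1) (2 * Besicovitch.multiplicity X)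
      ε lam ρ δ K)
    (hρr : ρ < r) (hlam : 0 ≤ lam) (hlamm : 4 * lam < m) (hε : 0 < ε)
    (hερ : 12 / C₀ * ε ≤ ρ * lam)
    (hfc : ∀ x ∈ D, f x ∉ closure Q → φ (f x) ≤ c + ε)
    (hfR : ∀ x ∈ D, f x ∉ closure Q → c - ε ≤ φ (f x) → f x ∈ Metric.ball 0 (R - 1))
    (hneg : ∀ x ∈ D, f x ∈ almostCritical ι μ φ Q c ε lam →
      HasNegativeSubspace ι φ (f x) lam (Module.finrank ℝ X + 1) ∨
        HasNegativeSubspace ι φ (-f x) lam (Module.finrank ℝ X + 1)) :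
    ∃ g S ξ, IsEquivariant ι μ σ D g ∧ IsDeformable ι μ φ V P Q R S c (2 * ε) ξ ∧
      ∀ x ∈ D, g x ∉ closure Q → φ (g x) ≤ c + 2 * ε ∧ (c - ε / 2 ≤ φ (g x) → g x ∈ S) := by
  obtain ⟨g, hg, hgf⟩ := hf.exists_deformation_below hμ hφ heven hσ hσ₂ hD hσD hQ hε hlam hscale
    hfc (fun x hx h => hfR x hx h.2.1 h.2.2.1)
    (fun x hx h v => notMem_closure_of_norm_sub_le hsep (fun u hu => (hV u hu).2) hm hscale hρr
      hlamm h (hfR x hx h.2.1 h.2.2.1)) hneg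
  have hρ := hscale.rho_pos
  refine ⟨g, {u | ∃ x ∈ D, g x = u ∧ u ∉ closure Q ∧ c - ε / 2 ≤ φ u}, ρ / 6, hg,
    isDeformable_of_near_noncritical hsep hC₀ (fun u hu => (hV u hu).1) hscale hρr (by positivity)
      (by positivity) (by linarith) ?_ ?_ ?_ ?_,
    fun x hx hxQ => ⟨((hgf x hx).2 hxQ).2.1, fun hlevel => ⟨x, hx, rfl, hxQ, hlevel⟩⟩⟩
  · rw [div_mul_eq_mul_div, div_le_iff₀ hC₀] at hερ
    rw [div_le_iff₀ (by positivity)]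
    linarith
  · rintro _ ⟨x, hx, rfl, hxQ, -⟩
    exact ⟨hg.mapsTo hx, hxQ⟩
  · rintro _ ⟨x, hx, rfl, hxQ, hlevel⟩
    exact ⟨σ x, hσD hx, hg.equivariant x hx, (neg_mem_closure_iff hQ).not.2 hxQ,
      by rwa [heven _ (hg.mapsTo hx)]⟩
  · rintro _ ⟨x, hx, rfl, hxQ, hlevel⟩
    obtain ⟨hdist, h⟩ := hgf x hx
    obtain ⟨hfQ, -, hfcrit⟩ := h hxQ
    obtain ⟨hflevel, hfcrit⟩ := hfcrit hlevel
    exact ⟨f x, ⟨⟨hf.mapsTo hx, hfQ⟩, hfR x hx hfQ hflevel, hfcrit⟩, hdist⟩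

theorem IsEquivariant.exists_mem_almostCritical (hf : IsEquivariant ι μ σ D f) (hμ : 0 < μ)
    (hφ : ContDiff ℝ 1 φ) (heven : ∀ u ∈ massSphere ι μ, φ (-u) = φ u)
    (hσ : Continuous σ) (hσ₂ : Function.Involutive σ) (hD : IsCompact D) (hσD : MapsTo σ D D)
    (hQ : ∀ u, -u ∈ Q ↔ u ∈ Q)
    (hsep : ∀ u ∈ P ∩ Metric.ball 0 R, ∀ v ∈ (massSphere ι μ ∩ Metric.ball 0 R) \ Q, r ≤ ‖u - v‖)
    (hC₀ : 0 < C₀)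
    (hV : ∀ u ∈ massSphere ι μ ∩ Metric.ball 0 R,
      C₀ * ‖constrainedDeriv ι φ u‖ ≤ ‖V u‖ ∧ ‖V u‖ ≤ ‖constrainedDeriv ι φ u‖)
    (hm : ∀ u ∈ (Metric.ball 0 R ∩ closure Q) \ P, m ≤ ‖V u‖)
    {η : Set E → ℝ → ℝ → ℝ → ℝ → E → E} (hη : FlowInvariance ι μ φ V P Q R η)
    (hc : ∀ S ε ξ, IsDeformable ι μ φ V P Q R S c ε ξ → ∀ g, IsEquivariant ι μ σ D g →
      (c : EReal) ≤ ⨆ u ∈ (η S c ε ξ ξ '' (g '' D)) \ closure Q, (φ u : EReal))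
    (hscale : IsDescentScale ι μ φ R (Module.finrank ℝ X + 1) (2 * Besicovitch.multiplicity X)
      ε lam ρ δ K)
    (hρr : ρ < r) (hlam : 0 ≤ lam) (hlamm : 4 * lam < m) (hε : 0 < ε)
    (hερ : 12 / C₀ * ε ≤ ρ * lam)
    (hfc : ∀ x ∈ D, f x ∉ closure Q → φ (f x) ≤ c + ε)
    (hfR : ∀ x ∈ D, f x ∉ closure Q → c - ε ≤ φ (f x) → f x ∈ Metric.ball 0 (R - 1)) :
    ∃ x ∈ D, f x ∈ almostCritical ι μ φ Q c ε lam ∧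
      ¬HasNegativeSubspace ι φ (f x) lam (Module.finrank ℝ X + 1) ∧
      ¬HasNegativeSubspace ι φ (-f x) lam (Module.finrank ℝ X + 1) := by
  by_contra! hneg
  obtain ⟨g, S, ξ, hg, hS, hgS⟩ := hf.exists_isDeformable hμ hφ heven hσ hσ₂ hD hσD hQ hsep hC₀ hV
    hm hscale hρr hlam hlamm hε hερ hfc hfR fun x hx h => or_iff_not_imp_left.2 (hneg x hx h)
  have hle := (hc S _ ξ hS g hg).trans
    ((hη S c _ ξ hS).iSup_le hS.xi_pos.le (by linarith : ε / 2 ≤ 2 * ε) hg.mapsTo hgS)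
  linarith [EReal.coe_le_coe_iff.1 hle]

end Minimax

end ConstrainedMinimax

open ConstrainedMinimax in
theorem theorem6_general {E H X : Type*} [NormedAddCommGroup E] [InnerProductSpace ℝ E]
    [NormedAddCommGroup H] [InnerProductSpace ℝ H] (ι : E →L[ℝ] H) (μ : ℝ) (hμ : 0 < μ)
    (φ : E → ℝ) (hφ : ContDiff ℝ 2 φ) (α : ℝ) (hα0 : 0 < α) (hα1 : α ≤ 1)
    (hHolder : HolderDerivsOnBounded φ α)
    (heven : ∀ u ∈ massSphere ι μ, φ (-u) = φ u)
    (R α₁ : ℝ) (hα₁0 : 0 < α₁) (hα₁ : α₁ ≤ α / (2 * (α + 2)))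
    (P Q : Set E) (hQ : ∀ u, -u ∈ Q ↔ u ∈ Q)
    (hsep : ∃ r : ℝ, 0 < r ∧ ∀ u ∈ P ∩ Metric.ball 0 R,
      ∀ v ∈ (massSphere ι μ ∩ Metric.ball 0 R) \ Q, r ≤ ‖u - v‖)
    (V : E → E) (C₀ : ℝ) (hC₀ : 0 < C₀)
    (hV : ∀ u ∈ massSphere ι μ ∩ Metric.ball 0 R,
      C₀ * ‖constrainedDeriv ι φ u‖ ≤ ‖V u‖ ∧
        ‖V u‖ ≤ ‖constrainedDeriv ι φ u‖)
    (η : Set E → ℝ → ℝ → ℝ → ℝ → E → E)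
    (hA1 : FlowInvariance ι μ φ V P Q R η)
    (hA2 : BoundedBelowOnCollar V P Q R)
    [NormedAddCommGroup X] [NormedSpace ℝ X] [FiniteDimensional ℝ X]
    (σ : X → X) (hσ : Continuous σ) (hσ₂ : Function.Involutive σ)
    (D : Set X) (hD : IsCompact D) (hσD : MapsTo σ D D) (c : ℝ)
    (hc : ∀ (S : Set E) (ε ξ : ℝ), IsDeformable ι μ φ V P Q R S c ε ξ →
      ∀ g : X → E, IsEquivariant ι μ σ D g →
        (c : EReal) ≤ ⨆ u ∈ (η S c ε ξ ξ '' (g '' D)) \ closure Q, (φ u : EReal)) :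
    ∃ ε₀ : ℝ, 0 < ε₀ ∧ ∀ ε : ℝ, 0 < ε → ε < ε₀ →
      ∀ f : X → E, IsEquivariant ι μ σ D f →
        (∀ u ∈ (f '' D) \ closure Q, φ u ≤ c + ε) →
        {u | u ∈ (f '' D) \ Q ∧ c - ε ≤ φ u} ⊆ Metric.ball 0 (R - 1) →
        ∃ u : E, ∀ v : E, v = u ∨ v = -u →
          v ∈ massSphere ι μ ∧
          (c - ε ≤ φ v ∧ φ v ≤ c + ε) ∧
          ‖V v‖ ≤ 3 * ε ^ α₁ ∧
          v ∈ (f '' D) \ closure Q ∧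
          ∀ W : Submodule ℝ E, W ≤ tangentSpace ι v →
            (∀ w ∈ W, w ≠ 0 →
              constrainedHessian ι φ v w w < -ε ^ α₁ * ‖w‖ ^ 2) →
            Module.rank ℝ W ≤ Module.finrank ℝ X := by
  obtain ⟨r, hr, hsep⟩ := hsep
  obtain ⟨m, hm, hA2⟩ := hA2
  obtain ⟨ε₀, hε₀, hsmall⟩ := mem_nhdsGT_iff_exists_Ioo_subset.1
    ((eventually_exists_isDescentScale (ι := ι) hμ hφ hα0 hα1 hHolder hα₁0 hα₁ R
      (Module.finrank ℝ X + 1) (2 * Besicovitch.multiplicity X) hr (12 / C₀)).and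
      ((tendsto_const_mul_rpow_nhdsGT_zero 4 hα₁0).eventually_lt_const hm))
  refine ⟨ε₀, hε₀, fun ε hε hεε₀ f hf hfc hfR => ?_⟩
  obtain ⟨⟨ρ, δ, K, hscale, hρr, hερ⟩, hεm⟩ := hsmall ⟨hε, hεε₀⟩
  have hfR' : ∀ x ∈ D, f x ∉ closure Q → c - ε ≤ φ (f x) → f x ∈ Metric.ball 0 (R - 1) :=
    fun x hx hxQ hlevel => hfR ⟨⟨mem_image_of_mem f hx, fun h => hxQ (subset_closure h)⟩, hlevel⟩
  obtain ⟨x, hx, hcrit, hneg, hneg_symm⟩ := hf.exists_mem_almostCritical hμ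
    (hφ.of_le one_le_two) heven hσ hσ₂ hD hσD hQ hsep hC₀ hV hA2 hA1 hc hscale hρr
    (Real.rpow_nonneg hε.le α₁) hεm hε hερ (fun x hx hxQ => hfc _ ⟨mem_image_of_mem f hx, hxQ⟩) hfR'
  have hpair : ∀ y, y = x ∨ y = σ x → y ∈ D ∧ f y ∈ almostCritical ι μ φ Q c ε (ε ^ α₁) ∧
      ¬HasNegativeSubspace ι φ (f y) (ε ^ α₁) (Module.finrank ℝ X + 1) := by
    rintro y (rfl | rfl)
    · exact ⟨hx, hcrit, hneg⟩
    · rw [hf.equivariant x hx]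
      exact ⟨hσD hx, neg_mem_almostCritical hμ (hφ.differentiable two_ne_zero) heven hQ hcrit,
        hneg_symm⟩
  refine ⟨f x, fun v hv => ?_⟩
  obtain ⟨y, hy, rfl⟩ : ∃ y, (y = x ∨ y = σ x) ∧ f y = v :=
    hv.elim (fun h => ⟨x, .inl rfl, h.symm⟩) fun h =>
      ⟨σ x, .inr rfl, by rw [hf.equivariant x hx, h]⟩
  obtain ⟨hyD, ⟨hyS, hyQ, hlevel, hycrit⟩, hyneg⟩ := hpair y hy
  have hyD' : f y ∈ (f '' D) \ closure Q := ⟨mem_image_of_mem f hyD, hyQ⟩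
  have hyR : f y ∈ Metric.ball 0 R :=
    Metric.ball_subset_ball (sub_le_self R zero_le_one) (hfR' y hyD hyQ hlevel)
  exact ⟨hyS, ⟨hlevel, hfc _ hyD'⟩, (hV _ ⟨hyS, hyR⟩).2.trans hycrit, hyD',
    fun W => rank_le_of_not_hasNegativeSubspace hyneg⟩

theorem theorem6 {E H : Type*}
    [NormedAddCommGroup E] [InnerProductSpace ℝ E] [CompleteSpace E]
    [NormedAddCommGroup H] [InnerProductSpace ℝ H] [CompleteSpace H]
    -- the Hilbert spaces `E ↪ H ↪ E'`
    (hEdim : ¬ FiniteDimensional ℝ E) (hHdim : ¬ FiniteDimensional ℝ H)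
    (ι : E →L[ℝ] H) (hι_inj : Function.Injective ι) (hι_norm : ‖ι‖ ≤ 1)
    (hι_dual : Function.Injective fun h : H => (innerSL ℝ h).comp ι)
    (μ : ℝ) (hμ : 0 < μ)
    -- the functional
    (φ : E → ℝ) (hφ : ContDiff ℝ 2 φ)
    (α : ℝ) (hα0 : 0 < α) (hα1 : α ≤ 1)
    (hHolder : ConstrainedMinimax.HolderDerivsOnBounded φ α)
    (heven : ∀ u ∈ ConstrainedMinimax.massSphere ι μ, φ (-u) = φ u)
    (R : ℝ) (hR : 1 < R)
    (α₁ : ℝ) (hα₁0 : 0 < α₁) (hα₁ : α₁ ≤ α / (2 * (α + 2)))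
    -- `P = P*`, `Q = P**`; inside the ball, `P` keeps a positive distance from `S_μ` minus `Q`
    (P Q : Set E) (hPQ : P ⊆ Q)
    (hP : ConstrainedMinimax.IsSymmOpenIn ι μ P) (hQ : ConstrainedMinimax.IsSymmOpenIn ι μ Q)
    (hsep : ∃ r : ℝ, 0 < r ∧ ∀ u ∈ P ∩ Metric.ball 0 R,
      ∀ v ∈ (ConstrainedMinimax.massSphere ι μ ∩ Metric.ball 0 R) \ Q, r ≤ ‖u - v‖)
    -- the pseudogradient
    (V : E → E) (hV : ConstrainedMinimax.IsPseudogradient ι μ φ V)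
    (C₀ : ℝ) (hC₀0 : 0 < C₀) (hC₀1 : C₀ ≤ 1)
    (hVbound : ∀ u ∈ ConstrainedMinimax.massSphere ι μ ∩ Metric.ball 0 R,
      C₀ * ‖ConstrainedMinimax.constrainedDeriv ι φ u‖ ≤ ‖V u‖ ∧
        ‖V u‖ ≤ ‖ConstrainedMinimax.constrainedDeriv ι φ u‖)
    -- conditions (A1) and (A2)
    (η : Set E → ℝ → ℝ → ℝ → ℝ → E → E)
    (hA1 : ConstrainedMinimax.FlowInvariance ι μ φ V P Q R η)
    (hA2 : ConstrainedMinimax.BoundedBelowOnCollar V P Q R)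
    -- the minimax inequality
    (d : ℕ) (σ : EuclideanSpace ℝ (Fin d) → EuclideanSpace ℝ (Fin d))
    (hσ_isom : Isometry σ) (hσ_inv : Function.Involutive σ)
    (D : Set (EuclideanSpace ℝ (Fin d))) (hD : IsCompact D) (hσD : σ '' D = D)
    (c : ℝ)
    (hc : ∀ (S : Set E) (ε ξ : ℝ), ConstrainedMinimax.IsDeformable ι μ φ V P Q R S c ε ξ →
      ∀ g : EuclideanSpace ℝ (Fin d) → E, ConstrainedMinimax.IsEquivariant ι μ σ D g →
        (c : EReal) ≤ ⨆ u ∈ (η S c ε ξ ξ '' (g '' D)) \ closure Q, (φ u : EReal)) :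
    ∃ ε₀ : ℝ, 0 < ε₀ ∧ ∀ ε : ℝ, 0 < ε → ε < ε₀ →
      ∀ f : EuclideanSpace ℝ (Fin d) → E, ConstrainedMinimax.IsEquivariant ι μ σ D f →
        (∀ u ∈ (f '' D) \ closure Q, φ u ≤ c + ε) →
        {u | u ∈ (f '' D) \ Q ∧ c - ε ≤ φ u} ⊆ Metric.ball 0 (R - 1) →
        ∃ u : E, ∀ v : E, v = u ∨ v = -u →
          v ∈ ConstrainedMinimax.massSphere ι μ ∧
          (c - ε ≤ φ v ∧ φ v ≤ c + ε) ∧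
          ‖V v‖ ≤ 3 * ε ^ α₁ ∧
          v ∈ (f '' D) \ closure Q ∧
          ∀ W : Submodule ℝ E, W ≤ ConstrainedMinimax.tangentSpace ι v →
            (∀ w ∈ W, w ≠ 0 →
              ConstrainedMinimax.constrainedHessian ι φ v w w < -ε ^ α₁ * ‖w‖ ^ 2) →
            Module.rank ℝ W ≤ d := by
  simpa only [finrank_euclideanSpace_fin] using theorem6_general ι μ hμ φ hφ α hα0 hα1 hHolder heven
    R α₁ hα₁0 hα₁ P Q hQ.symm hsep V C₀ hC₀0 hVbound η hA1 hA2 σ hσ_isom.continuous hσ_inv D hD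
    (mapsTo_iff_image_subset.2 hσD.le) c hc
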